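/- Let $2\le p<\infty$, $c_0<1/2$ and $A_p\ge 0$. There is a constant $C_p$, depending only on $p$, $c_0$ and $A_p$, such that the following holds. Let $0<\delta<1$ and let $m:\mathbb{R}\to\mathbb{C}$ be an $L^p(\mathbb{R})$ multiplier of norm $A_p$; that is, $m$ is bounded and measurable, and the operator $Tf=\mathscr{F}^{-1}(m\cdot\mathscr{F}f)$, where $(\mathscr{F}f)(\xi)=\int_{\mathbb{R}}f(x)e^{-2\pi i x\xi}\,dx$, satisfies $\|Tf\|_{L^p(\mathbb{R})}\le A_p\|f\|_{L^p(\mathbb{R})}$ for all Schwartz functions $f$ (equivalently, $T$ extends to a bounded operator on $L^p(\mathbb{R})$ of norm at most $A_p$). Assume that $m$ is supported in $|\xi|\le c_0\delta$. Let $\{\xi_j\}$ be a $\delta$-separated set of points in $(-1/2,1/2]$, meaning that every open interval of length $\delta$ contains at most one point of the set. For each $j$ let $T_j$ be the discrete operator on functions of $\mathbb{Z}$ with multiplier $m(\xi-\xi_j)$ (periodized), that is, $$T_jf(n)=\sum_{k\in\mathbb{Z}}f(n-k)K_j(k),\qquad K_j(x)=\int_{\mathbb{R}}m(\xi-\xi_j)e^{2\pi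 i x\xi}\,d\xi .$$ Then for every $f\in\ell^p(\mathbb{Z})$ the series defining $T_jf(n)$ converges absolutely for every $j$ and $n$, and $$\Big\|\Big(\sum_j|T_jf|^2\Big)^{1/2}\Big\|_{\ell^p(\mathbb{Z})}\le C_p\,\|f\|_{\ell^p(\mathbb{Z})}.$$ -/

import Mathlib

open MeasureTheory
open scoped ENNReal NNReal FourierTransform SchwartzMap

namespace DiscreteMultiplier

/-- A bounded, (Lebesgue) measurable function `m : ℝ → ℂ` is an `L^p(ℝ)` multiplier of norm (at
most) `A` if the operator `T f = 𝓕⁻ (m · 𝓕 f)` satisfies `‖T f‖_p ≤ A ‖f‖_p`.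
The bound is required on Schwartz functions, where `𝓕⁻ (m · 𝓕 f)` is an absolutely convergent
integral; they are dense in `L^p(ℝ)` for `1 ≤ p < ∞`, and `T` is then extended by continuity.
The normalization is `𝓕 f ξ = ∫ f(x) e^{-2πixξ} dx`. -/
structure IsLpMultiplier (p : ℝ≥0∞) (A : ℝ≥0) (m : ℝ → ℂ) : Prop where
  aemeasurable : AEMeasurable m volume
  bounded : ∃ B : ℝ, ∀ ξ, ‖m ξ‖ ≤ B
  norm_le : ∀ f : 𝓢(ℝ, ℂ),
    eLpNorm (𝓕⁻ (fun ξ : ℝ => m ξ * 𝓕 (f : ℝ → ℂ) ξ)) p volume ≤ A * eLpNorm f p volume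

/-- A set of real numbers is `δ`-separated if every open interval of length `δ` contains at most
one of its points. -/
def IsDeltaSeparated (δ : ℝ) (S : Set ℝ) : Prop :=
  ∀ a : ℝ, (S ∩ Set.Ioo a (a + δ)).Subsingleton

/-- The convolution kernel `K(x) = ∫ m(ξ) e^{2πixξ} dξ` of the operator on `ℝ` with
(bounded, compactly supported) multiplier `m`. -/
noncomputable def kernel (m : ℝ → ℂ) (x : ℝ) : ℂ := 𝓕⁻ m x

/-- The discrete operator on functions of `ℤ` associated with the multiplier `m`:
convolution with the restriction of the kernel to the integers. -/
noncomputable def discreteOp (m : ℝ → ℂ) (f : ℤ → ℂ) (n : ℤ) : ℂ :=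
  ∑' k : ℤ, f (n - k) * kernel m (k : ℝ)

/-- The multiplier `ξ ↦ m(ξ - η)`. -/
def shift (m : ℝ → ℂ) (η : ℝ) : ℝ → ℂ := fun ξ => m (ξ - η)

/-- The square function `n ↦ (∑_{η ∈ S} |T_η f(n)|²)^{1/2}`, where `T_η` is the discrete operator
with multiplier `m(ξ - η)`. It is used for finite sets `S` only, since a bounded `δ`-separated
set is finite. -/
noncomputable def squareFunction (m : ℝ → ℂ) (S : Set ℝ) (f : ℤ → ℂ) (n : ℤ) : ℝ :=
  Real.sqrt (∑' η : S, ‖discreteOp (shift m η) f n‖ ^ 2)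

end DiscreteMultiplier

/-!
Write `K` for the kernel of `m`. Since the kernel of `m(ξ - ξ_j)` is `𝐞(ξ_j x) K(x)`, the function
`|T_j f|` is the modulus of the discrete convolution of `K` with the modulation
`f_j(k) = f(k) 𝐞(-ξ_j k)`. Assume first that `f` has finite support, and choose a smooth even `χ`,
equal to `1` on `[-c₀, c₀]` and vanishing outside a compact subinterval of `(-1/2, 1/2)`; let
`φ(ξ) = χ(ξ/δ)`, so that `m φ = m`.

The sequence `f_j` is extended to the Schwartz function `G_j(x) = ∑ f_j(k) φ^∨(x - k)`. Because
`m φ = m`, the operator on `ℝ` with multiplier `m` maps `G_j` to `x ↦ ∑ f_j(k) K(x - k)`, whose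
values at the integers are the discrete convolution. That function has spectrum in `[-1, 1]`, so its
`ℓ^p` norm on `ℤ` is at most a constant times its `L^p` norm (`exists_sampling`). Hence the `L^p(ℝ)`
bound for `m` controls the discrete operator by the functions `G_j` (`exists_transference`).
Applying this to the random sums `∑ ± f_j` and using Khintchine's inequality on both sides replaces
`(∑ |T_j f|²)^{1/2}` by `(∑ |G_j|²)^{1/2}`.

The latter no longer involves `m`. The functions `𝐞(ξ_j y) φ^∨(y - x)` have disjoint spectra and so
are orthogonal on `ℝ`; the same is true after multiplication by `y - x`, which is differentiation
of `φ`. By sampling with exponent `2` they satisfy a weighted Bessel inequality on `ℤ`, and its dual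
is the large sieve bound `∑ |G_j(x)|² ≤ C ∑ |f(n)|² δ / (1 + δ² (x - n)²)` (`exists_large_sieve`).
As `p / 2 ≥ 1`, Schur's test bounds the `L^{p/2}(ℝ)` norm of the right side by `‖f‖_p²`.

For general `f ∈ ℓ^p`, testing the finite inequality with one frequency on `f` multiplied by
suitable phases gives absolute convergence, and Fatou's lemma gives the estimate.
-/

namespace DiscreteMultiplier

/-! ### Schur's test and the Cauchy kernel -/

/-- Jensen's inequality for a measure with density `k`, in a form that allows the total mass of
`k` to be any number. -/
lemma lintegral_mul_rpow_le {α : Type*} [MeasurableSpace α] {μ : Measure α} {p : ℝ} (hp : 1 ≤ p)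
    {k f : α → ℝ≥0∞} (hk : Measurable k) (hf : Measurable f) :
    (∫⁻ x, k x * f x ∂μ) ^ p ≤ (∫⁻ x, k x ∂μ) ^ (p - 1) * ∫⁻ x, k x * f x ^ p ∂μ := by
  have hp0 : 0 < p := by linarith
  have h1 : 0 ≤ 1 - 1 / p := by
    rw [sub_nonneg, div_le_one hp0]; exact hp
  have h2 : 0 ≤ 1 / p := by positivity
  have key := ENNReal.lintegral_mul_norm_pow_le (μ := μ) (f := k) (g := fun x => k x * f x ^ p)
    hk.aemeasurable (hk.mul (hf.pow_const p)).aemeasurable h1 h2 (by ring)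
  have e : ∀ x, k x ^ (1 - 1 / p) * (k x * f x ^ p) ^ (1 / p) = k x * f x := by
    intro x
    rw [ENNReal.mul_rpow_of_nonneg _ _ h2, ← mul_assoc, ← ENNReal.rpow_add_of_nonneg _ _ h1 h2,
      ← ENNReal.rpow_mul, mul_one_div_cancel hp0.ne']
    simp
  simp_rw [e] at key
  calc (∫⁻ x, k x * f x ∂μ) ^ p
      ≤ ((∫⁻ x, k x ∂μ) ^ (1 - 1 / p) * (∫⁻ x, k x * f x ^ p ∂μ) ^ (1 / p)) ^ p :=
        ENNReal.rpow_le_rpow key hp0.le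
    _ = _ := by
        rw [ENNReal.mul_rpow_of_nonneg _ _ hp0.le, ← ENNReal.rpow_mul, ← ENNReal.rpow_mul,
          one_div_mul_cancel hp0.ne', ENNReal.rpow_one]
        congr 2
        field_simp

/-- **Schur's test** for a positive kernel. -/
lemma lintegral_schur {α β : Type*} [MeasurableSpace α] [MeasurableSpace β]
    {μ : Measure α} {ν : Measure β} [SFinite μ] [SFinite ν] {p : ℝ} (hp : 1 ≤ p)
    {k : α → β → ℝ≥0∞} (hk : Measurable (Function.uncurry k)) {f : β → ℝ≥0∞} (hf : Measurable f)
    {A B : ℝ≥0∞} (hA : ∀ x, ∫⁻ y, k x y ∂ν ≤ A) (hB : ∀ y, ∫⁻ x, k x y ∂μ ≤ B) :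
    ∫⁻ x, (∫⁻ y, k x y * f y ∂ν) ^ p ∂μ ≤ A ^ (p - 1) * B * ∫⁻ y, f y ^ p ∂ν := by
  calc ∫⁻ x, (∫⁻ y, k x y * f y ∂ν) ^ p ∂μ
      ≤ ∫⁻ x, A ^ (p - 1) * ∫⁻ y, k x y * f y ^ p ∂ν ∂μ := by
        refine lintegral_mono fun x => ?_
        refine (lintegral_mul_rpow_le hp (hk.of_uncurry_left) hf).trans ?_
        gcongr
        · exact hA x
    _ = A ^ (p - 1) * ∫⁻ y, ∫⁻ x, k x y * f y ^ p ∂μ ∂ν := by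
        have hm : Measurable (Function.uncurry fun x y => k x y * f y ^ p) :=
          hk.mul ((hf.pow_const p).comp measurable_snd)
        rw [lintegral_const_mul _ hm.lintegral_prod_right, lintegral_lintegral_swap hm.aemeasurable]
    _ ≤ A ^ (p - 1) * ∫⁻ y, B * f y ^ p ∂ν := by
        gcongr with y
        rw [lintegral_mul_const _ (hk.of_uncurry_right)]
        gcongr
        exact hB y
    _ = _ := by rw [lintegral_const_mul _ (hf.pow_const p), mul_assoc]

/-- The Cauchy kernel `δ / (1 + δ² (x - y)²)` of width `1 / δ`, which dominates the smooth
averages at that scale. -/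
noncomputable def cauchyKernel (δ x y : ℝ) : ℝ≥0∞ := ENNReal.ofReal (δ / (1 + (δ * (x - y)) ^ 2))

lemma measurable_cauchyKernel (δ : ℝ) : Measurable (Function.uncurry (cauchyKernel δ)) := by
  unfold cauchyKernel Function.uncurry
  fun_prop

lemma cauchyKernel_comm (δ x y : ℝ) : cauchyKernel δ x y = cauchyKernel δ y x := by
  unfold cauchyKernel
  congr 3
  ring

lemma lintegral_cauchyKernel {δ : ℝ} (hδ : 0 < δ) (x : ℝ) :
    ∫⁻ y, cauchyKernel δ x y = ENNReal.ofReal Real.pi := by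
  have hI : Integrable (fun y : ℝ => (1 + (δ * (x - y)) ^ 2)⁻¹) := by
    have := (integrable_inv_one_add_sq.comp_mul_left' hδ.ne')
    exact this.comp_sub_left x
  have hI' : Integrable (fun y : ℝ => δ / (1 + (δ * (x - y)) ^ 2)) := by
    simpa only [div_eq_mul_inv] using hI.const_mul δ
  unfold cauchyKernel
  rw [← ofReal_integral_eq_lintegral_ofReal hI' (Filter.Eventually.of_forall fun y => by positivity)]
  congr 1
  simp_rw [div_eq_mul_inv]
  rw [integral_const_mul,
    integral_sub_left_eq_self (fun y : ℝ => (1 + (δ * y) ^ 2)⁻¹) volume x,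
    Measure.integral_comp_mul_left (fun y : ℝ => (1 + y ^ 2)⁻¹) δ, integral_univ_inv_one_add_sq]
  rw [abs_of_pos (by positivity), smul_eq_mul, mul_inv_cancel_left₀ hδ.ne']

/-- For `δ ≤ 1` the Cauchy kernel varies by a bounded factor on unit intervals, so its sum over the
integers is comparable to its integral. -/
lemma tsum_cauchyKernel_le {δ : ℝ} (hδ : 0 < δ) (hδ1 : δ ≤ 1) (x : ℝ) :
    ∑' n : ℤ, cauchyKernel δ x n ≤ 3 * ENNReal.ofReal Real.pi := by
  have h : ∀ n : ℤ, cauchyKernel δ x n ≤ ∫⁻ y in Set.Ioc (n : ℝ) (n + 1), 3 * cauchyKernel δ x y := by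
    intro n
    calc cauchyKernel δ x n = ∫⁻ _ in Set.Ioc (n : ℝ) (n + 1), cauchyKernel δ x n := by simp
      _ ≤ _ := by
        refine setLIntegral_mono' measurableSet_Ioc fun y hy => ?_
        unfold cauchyKernel
        rw [show (3 : ℝ≥0∞) = ENNReal.ofReal 3 by simp, ← ENNReal.ofReal_mul (by norm_num)]
        refine ENNReal.ofReal_le_ofReal ?_
        rw [← mul_div_assoc, div_le_div_iff₀ (by positivity) (by positivity)]
        have h1 : 0 ≤ δ * (y - n) := mul_nonneg hδ.le (by linarith [hy.1])
        have h2 : δ * (y - n) ≤ 1 := by nlinarith [hy.1, hy.2]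
        -- `(a - t)² ≤ 2a² + 2` for `t = δ(y - n) ∈ [0, 1]`
        have h3 : (δ * (x - y)) ^ 2 ≤ 2 * (δ * (x - n)) ^ 2 + 2 := by
          have : δ * (x - y) = δ * (x - n) - δ * (y - n) := by ring
          rw [this]
          nlinarith [sq_nonneg (δ * (x - n) + δ * (y - n))]
        nlinarith [sq_nonneg (δ * (x - n))]
  calc ∑' n : ℤ, cauchyKernel δ x n
      ≤ ∑' n : ℤ, ∫⁻ y in Set.Ioc (n : ℝ) (n + 1), 3 * cauchyKernel δ x y := ENNReal.tsum_le_tsum h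
    _ = ∫⁻ y, 3 * cauchyKernel δ x y := by
        rw [← lintegral_iUnion (fun n => measurableSet_Ioc) (Set.pairwise_disjoint_Ioc_intCast ℝ),
          iUnion_Ioc_intCast, setLIntegral_univ]
    _ = _ := by
        rw [lintegral_const_mul _ ((measurable_cauchyKernel δ).of_uncurry_left),
          lintegral_cauchyKernel hδ]

/-! ### Sampling band-limited functions at the integers -/

lemma fourierInv_real_eq (f : ℝ → ℂ) (w : ℝ) : 𝓕⁻ f w = ∫ v : ℝ, (𝐞 (v * w) : ℂ) * f v := by
  rw [Real.fourierInv_eq]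
  congr 1; ext v
  rw [Circle.smul_def, smul_eq_mul]
  simp [mul_comm]

lemma continuous_fourierInv {h : ℝ → ℂ} (hh : Integrable h) : Continuous (𝓕⁻ h) := by
  have : 𝓕⁻ h = fun x => 𝓕 h (-x) := by ext x; exact Real.fourierInv_eq_fourier_neg h x
  rw [this]
  exact (VectorFourier.fourierIntegral_continuous Real.continuous_fourierChar
    (by exact continuous_inner) hh).comp continuous_neg

lemma exists_schwartz_le_cauchyKernel (Ψ : 𝓢(ℝ, ℂ)) :
    ∃ C : ℝ≥0, ∀ x y : ℝ, ‖Ψ (x - y)‖ₑ ≤ C * cauchyKernel 1 x y := by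
  obtain ⟨C0, hC0⟩ := Ψ.decay 0 0
  obtain ⟨C2, hC2⟩ := Ψ.decay 2 0
  refine ⟨(C0 + C2).toNNReal, fun x y => ?_⟩
  have h0 := hC0.2 (x - y)
  have h2 := hC2.2 (x - y)
  simp only [pow_zero, norm_iteratedFDeriv_zero, one_mul, Real.norm_eq_abs, sq_abs] at h0 h2
  rw [← ofReal_norm, cauchyKernel, ← ENNReal.ofReal, ← ENNReal.ofReal_mul (by linarith [hC0.1, hC2.1])]
  refine ENNReal.ofReal_le_ofReal ?_
  rw [mul_one_div, le_div_iff₀ (by positivity)]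
  nlinarith

lemma exists_smooth_cutoff {r R : ℝ} (hr : 0 < r) (hR : r < R) :
    ∃ χ : 𝓢(ℝ, ℂ), (∀ ξ, |ξ| ≤ r → χ ξ = 1) ∧ (∀ ξ, R ≤ |ξ| → χ ξ = 0) ∧ ∀ ξ, χ (-ξ) = χ ξ := by
  let b : ContDiffBump (0 : ℝ) := ⟨r, R, hr, hR⟩
  have hc : HasCompactSupport (fun x => (b x : ℂ)) :=
    b.hasCompactSupport.comp_left (g := fun x : ℝ => (x : ℂ)) (by simp)
  have hs : ContDiff ℝ (⊤ : ℕ∞) (fun x => (b x : ℂ)) :=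
    Complex.ofRealCLM.contDiff.comp b.contDiff
  refine ⟨hc.toSchwartzMap hs, fun ξ h => ?_, fun ξ h => ?_, fun ξ => ?_⟩
  · have : b ξ = 1 := b.one_of_mem_closedBall (by simpa [Real.dist_eq] using h)
    simp [this]
  · have : b ξ = 0 := b.zero_of_le_dist (by simpa [Real.dist_eq] using h)
    simp [this]
  · simp [b.neg ξ]

/-- A function with spectrum in `[-1, 1]` is reproduced by convolution with any Schwartz function
whose Fourier transform is `1` there. -/
lemma fourierInv_eq_integral_mul {Ψ : 𝓢(ℝ, ℂ)} (hΨ : ∀ ξ, |ξ| ≤ 1 → 𝓕 (Ψ : ℝ → ℂ) ξ = 1)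
    {h : ℝ → ℂ} (hh : Integrable h) (hs : ∀ ξ, 1 < |ξ| → h ξ = 0) (x : ℝ) :
    𝓕⁻ h x = ∫ y, 𝓕⁻ h y * Ψ (x - y) := by
  let g : ℝ → ℂ := fun y => Ψ (x + y)
  have hg : Integrable g := Ψ.integrable.comp_add_left x
  have flip := VectorFourier.integral_fourierIntegral_smul_eq_flip (L := innerₗ ℝ)
    Real.continuous_fourierChar continuous_inner hh hg
  have e1 : ∫ y, 𝓕⁻ h y * Ψ (x - y) = ∫ y, 𝓕 h y * g y := by
    rw [← integral_neg_eq_self]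
    congr 1; ext y
    rw [Real.fourierInv_eq_fourier_neg]
    simp [g]
  have e2 : ∀ ξ, 𝓕 g ξ = 𝐞 (ξ * x) * 𝓕 (Ψ : ℝ → ℂ) ξ := by
    intro ξ
    rw [Real.fourier_real_eq, Real.fourier_real_eq, ← integral_const_mul]
    rw [← integral_add_left_eq_self (fun v => (𝐞 (ξ * x) : ℂ) * 𝐞 (-(v * ξ)) • Ψ v) x]
    congr 1; ext y
    rw [Circle.smul_def, Circle.smul_def, smul_eq_mul, smul_eq_mul, ← mul_assoc, ← Circle.coe_mul,
      ← AddChar.map_add_eq_mul]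
    congr 3
    ring_nf
  rw [e1]
  refine Eq.trans ?_ flip.symm
  rw [fourierInv_real_eq]
  congr 1; ext ξ
  have e3 : VectorFourier.fourierIntegral 𝐞 volume (innerₗ ℝ).flip g ξ = 𝓕 g ξ := by
    rw [flip_innerₗ]; rfl
  rw [e3, e2, smul_eq_mul]
  by_cases hξ : |ξ| ≤ 1
  · rw [hΨ ξ hξ]; ring
  · rw [hs ξ (not_le.1 hξ)]; ring

/-- **Sampling inequality** (Plancherel–Pólya): for functions with spectrum in `[-1, 1]`, the
`ℓ^p` norm over the integers is controlled by the `L^p` norm. -/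
lemma exists_sampling {p : ℝ} (hp : 1 ≤ p) : ∃ C : ℝ≥0, ∀ h : ℝ → ℂ, Integrable h →
    (∀ ξ, 1 < |ξ| → h ξ = 0) →
    ∑' n : ℤ, ‖𝓕⁻ h (n : ℝ)‖ₑ ^ p ≤ C * ∫⁻ x, ‖𝓕⁻ h x‖ₑ ^ p := by
  obtain ⟨χ, hχ, -, -⟩ := exists_smooth_cutoff one_pos one_lt_two
  obtain ⟨Ψ, hΨ⟩ : ∃ Ψ : 𝓢(ℝ, ℂ), 𝓕 (Ψ : ℝ → ℂ) = χ :=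
    ⟨𝓕⁻ χ, by rw [← SchwartzMap.fourier_coe, FourierTransform.fourier_fourierInv_eq]⟩
  obtain ⟨C, hC⟩ := exists_schwartz_le_cauchyKernel Ψ
  refine ⟨(C * Real.pi.toNNReal) ^ (p - 1) * (C * (3 * Real.pi.toNNReal)), fun h hh hs => ?_⟩
  have hmeas : Measurable fun y => ‖𝓕⁻ h y‖ₑ := (continuous_fourierInv hh).measurable.enorm
  let k : ℤ → ℝ → ℝ≥0∞ := fun n y => C * cauchyKernel 1 n y
  have hk : Measurable (Function.uncurry k) := by
    have hcast : Measurable fun q : ℤ × ℝ => ((q.1 : ℝ), q.2) :=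
      ((measurable_of_countable (fun n : ℤ => (n : ℝ))).comp measurable_fst).prodMk measurable_snd
    exact ((measurable_cauchyKernel 1).comp hcast).const_mul (C : ℝ≥0∞)
  have hpt : ∀ n : ℤ, ‖𝓕⁻ h (n : ℝ)‖ₑ ≤ ∫⁻ y, k n y * ‖𝓕⁻ h y‖ₑ := by
    intro n
    rw [fourierInv_eq_integral_mul (fun ξ hξ => by rw [hΨ, hχ ξ hξ]) hh hs]
    refine (enorm_integral_le_lintegral_enorm _).trans (lintegral_mono fun y => ?_)
    rw [enorm_mul, mul_comm]
    exact mul_le_mul_left (hC n y) _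
  have hpi : (Real.pi.toNNReal : ℝ≥0∞) = ENNReal.ofReal Real.pi := rfl
  calc ∑' n : ℤ, ‖𝓕⁻ h (n : ℝ)‖ₑ ^ p
      ≤ ∑' n : ℤ, (∫⁻ y, k n y * ‖𝓕⁻ h y‖ₑ) ^ p :=
        ENNReal.tsum_le_tsum fun n => ENNReal.rpow_le_rpow (hpt n) (by linarith)
    _ = ∫⁻ n : ℤ, (∫⁻ y, k n y * ‖𝓕⁻ h y‖ₑ) ^ p ∂Measure.count := (lintegral_count _).symm
    _ ≤ (C * ENNReal.ofReal Real.pi) ^ (p - 1) * (C * (3 * ENNReal.ofReal Real.pi)) *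
          ∫⁻ x, ‖𝓕⁻ h x‖ₑ ^ p := by
        refine lintegral_schur hp hk hmeas (fun n => ?_) (fun y => ?_)
        · rw [lintegral_const_mul _ ((measurable_cauchyKernel 1).of_uncurry_left),
            lintegral_cauchyKernel one_pos]
        · rw [lintegral_count, ENNReal.tsum_mul_left]
          gcongr
          simp_rw [cauchyKernel_comm 1 _ y]
          exact tsum_cauchyKernel_le one_pos le_rfl y
    _ = _ := by
        rw [← hpi]
        push_cast
        rw [ENNReal.coe_rpow_of_nonneg _ (by linarith)]
        push_cast
        rfl

/-! ### Khintchine's inequality -/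

section Khintchine

variable {ι : Type*} [Fintype ι]

lemma sum_units_int {M : Type*} [AddCommMonoid M] (f : ℤˣ → M) : ∑ u, f u = f 1 + f (-1) := by
  have : (Finset.univ : Finset ℤˣ) = {1, -1} := by decide
  rw [this, Finset.sum_pair (by decide)]

lemma card_signs_pos [DecidableEq ι] : (0 : ℝ) < Fintype.card (ι → ℤˣ) := by exact_mod_cast Fintype.card_pos

lemma sum_sign_mul_sign [DecidableEq ι] (i j : ι) :
    ∑ ε : ι → ℤˣ, (((ε i : ℤ) : ℝ) * ((ε j : ℤ) : ℝ))
      = if i = j then (Fintype.card (ι → ℤˣ) : ℝ) else 0 := by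
  split_ifs with h
  · subst h
    have : ∀ ε : ι → ℤˣ, (((ε i : ℤ) : ℝ) * ((ε i : ℤ) : ℝ)) = 1 := fun ε => by
      rw [← Int.cast_mul, ← Units.val_mul, Int.units_mul_self]; simp
    simp [this]
  · -- flipping the sign of index `i` changes the sign of the sum
    have := Equiv.sum_comp (Equiv.mulLeft (Pi.mulSingle i (-1) : ι → ℤˣ))
      (fun ε : ι → ℤˣ => ((ε i : ℤ) : ℝ) * ((ε j : ℤ) : ℝ))
    simp [Ne.symm h] at this
    linarith

lemma sum_sq_sum_sign [DecidableEq ι] (a : ι → ℝ) :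
    ∑ ε : ι → ℤˣ, (∑ j, ((ε j : ℤ) : ℝ) * a j) ^ 2
      = Fintype.card (ι → ℤˣ) * ∑ j, a j ^ 2 := by
  calc ∑ ε : ι → ℤˣ, (∑ j, ((ε j : ℤ) : ℝ) * a j) ^ 2
      = ∑ ε : ι → ℤˣ, ∑ i, ∑ j, a i * a j * (((ε i : ℤ) : ℝ) * ((ε j : ℤ) : ℝ)) := by
        refine Finset.sum_congr rfl fun ε _ => ?_
        rw [sq, Finset.sum_mul_sum]
        refine Finset.sum_congr rfl fun i _ => Finset.sum_congr rfl fun j _ => ?_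
        ring
    _ = ∑ i, ∑ j, a i * a j * ∑ ε : ι → ℤˣ, (((ε i : ℤ) : ℝ) * ((ε j : ℤ) : ℝ)) := by
        rw [Finset.sum_comm]
        refine Finset.sum_congr rfl fun i _ => ?_
        rw [Finset.sum_comm]
        simp_rw [Finset.mul_sum]
    _ = _ := by
        simp_rw [sum_sign_mul_sign, mul_ite, mul_zero, Finset.sum_ite_eq, Finset.mem_univ, if_true,
          Finset.mul_sum]
        refine Finset.sum_congr rfl fun i _ => ?_
        ring

lemma re_sum_sign (a : ι → ℂ) (ε : ι → ℤˣ) :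
    (∑ j, ((ε j : ℤ) : ℂ) * a j).re = ∑ j, ((ε j : ℤ) : ℝ) * (a j).re := by
  simp [Complex.re_sum, Complex.mul_re]

lemma im_sum_sign (a : ι → ℂ) (ε : ι → ℤˣ) :
    (∑ j, ((ε j : ℤ) : ℂ) * a j).im = ∑ j, ((ε j : ℤ) : ℝ) * (a j).im := by
  simp [Complex.im_sum, Complex.mul_im]

lemma sum_norm_sq_sum_sign [DecidableEq ι] (a : ι → ℂ) :
    ∑ ε : ι → ℤˣ, ‖∑ j, ((ε j : ℤ) : ℂ) * a j‖ ^ 2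
      = Fintype.card (ι → ℤˣ) * ∑ j, ‖a j‖ ^ 2 := by
  have h : ∀ z : ℂ, ‖z‖ ^ 2 = z.re ^ 2 + z.im ^ 2 := fun z => by
    rw [Complex.sq_norm, Complex.normSq_apply]; ring
  simp_rw [h, Finset.sum_add_distrib, re_sum_sign, im_sum_sign]
  rw [sum_sq_sum_sign, sum_sq_sum_sign, mul_add]

/-- The lower half of Khintchine's inequality, for exponents at least `2`, is Jensen's
inequality. -/
lemma khintchine_lower [DecidableEq ι] {p : ℝ} (hp : 2 ≤ p) (a : ι → ℂ) :
    Fintype.card (ι → ℤˣ) * (∑ j, ‖a j‖ ^ 2) ^ (p / 2)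
      ≤ ∑ ε : ι → ℤˣ, ‖∑ j, ((ε j : ℤ) : ℂ) * a j‖ ^ p := by
  have hN := card_signs_pos (ι := ι)
  set N : ℝ := (Fintype.card (ι → ℤˣ) : ℝ) with hNdef
  have key := Real.rpow_arith_mean_le_arith_mean_rpow Finset.univ (fun _ : ι → ℤˣ => N⁻¹)
    (fun ε => ‖∑ j, ((ε j : ℤ) : ℂ) * a j‖ ^ 2) (fun _ _ => by positivity)
    (by simp [hNdef, -Fintype.card_pi]) (fun _ _ => by positivity) (p := p / 2) (by linarith)
  rw [← Finset.mul_sum, ← Finset.mul_sum, sum_norm_sq_sum_sign, inv_mul_cancel_left₀ hN.ne'] at key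
  rw [← div_eq_inv_mul, le_div_iff₀ hN] at key
  refine (mul_comm _ _).trans_le (key.trans_eq (Finset.sum_congr rfl fun ε _ => ?_))
  rw [← Real.rpow_natCast, ← Real.rpow_mul (norm_nonneg _)]
  congr 1
  push_cast; ring

/-- The exponential moments of a sum with random signs are subgaussian: they factor over the
indices, and `cosh t ≤ exp (t² / 2)`. -/
lemma sum_exp_sum_sign_le [DecidableEq ι] (a : ι → ℝ) :
    ∑ ε : ι → ℤˣ, Real.exp (∑ j, ((ε j : ℤ) : ℝ) * a j)
      ≤ Fintype.card (ι → ℤˣ) * Real.exp ((∑ j, a j ^ 2) / 2) := by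
  simp_rw [Real.exp_sum]
  calc ∑ ε : ι → ℤˣ, ∏ j, Real.exp (((ε j : ℤ) : ℝ) * a j)
      = ∏ j, ∑ u : ℤˣ, Real.exp (((u : ℤ) : ℝ) * a j) := by
        rw [Finset.prod_univ_sum, Fintype.piFinset_univ]
    _ = ∏ j, 2 * Real.cosh (a j) := by
        refine Finset.prod_congr rfl fun j _ => ?_
        rw [sum_units_int, Real.cosh_eq]
        simp
        ring
    _ ≤ ∏ j, 2 * Real.exp (a j ^ 2 / 2) := by
        refine Finset.prod_le_prod (fun j _ => by positivity) fun j _ => ?_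
        gcongr
        exact Real.cosh_le_exp_half_sq _
    _ = _ := by
        rw [Finset.prod_mul_distrib, ← Real.exp_sum, Finset.sum_div]
        simp

/-- Up to a constant, any power is dominated by `2 cosh`, so exponential moments bound all moments. -/
lemma abs_rpow_le_cosh {p : ℝ} (hp : 0 ≤ p) (x : ℝ) :
    |x| ^ p ≤ (⌈p⌉₊).factorial * (Real.exp x + Real.exp (-x)) := by
  set k := ⌈p⌉₊
  have hf : (1 : ℝ) ≤ (k.factorial : ℝ) := by exact_mod_cast Nat.factorial_pos k
  have he : Real.exp |x| ≤ Real.exp x + Real.exp (-x) := Real.exp_abs_le x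
  refine le_trans ?_ (mul_le_mul_of_nonneg_left he (by positivity))
  rcases le_total |x| 1 with h | h
  · calc |x| ^ p ≤ 1 := Real.rpow_le_one (abs_nonneg _) h hp
      _ ≤ k.factorial * Real.exp |x| :=
        one_le_mul_of_one_le_of_one_le hf (Real.one_le_exp (abs_nonneg _))
  · calc |x| ^ p ≤ |x| ^ (k : ℝ) := Real.rpow_le_rpow_of_exponent_le h (Nat.le_ceil p)
      _ = |x| ^ k := Real.rpow_natCast _ _
      _ ≤ k.factorial * Real.exp |x| := by
        have := Real.pow_div_factorial_le_exp |x| (abs_nonneg _) k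
        rwa [div_le_iff₀ (by positivity), mul_comm] at this

/-- The upper half of Khintchine's inequality for real coefficients, from the subgaussian bound on
the exponential moments. -/
lemma khintchine_upper_real [DecidableEq ι] {p : ℝ} (hp : 0 < p) (a : ι → ℝ) :
    ∑ ε : ι → ℤˣ, |∑ j, ((ε j : ℤ) : ℝ) * a j| ^ p
      ≤ 2 * (⌈p⌉₊).factorial * Real.exp (1 / 2) * Fintype.card (ι → ℤˣ)
        * (∑ j, a j ^ 2) ^ (p / 2) := by
  set s := ∑ j, a j ^ 2 with hs
  have hs0 : 0 ≤ s := Finset.sum_nonneg fun j _ => sq_nonneg _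
  rcases hs0.eq_or_lt with h0 | h0
  · have ha : ∀ j, a j = 0 := fun j => by
      have := (Finset.sum_eq_zero_iff_of_nonneg (fun j _ => sq_nonneg (a j))).1 h0.symm j
        (Finset.mem_univ j)
      exact pow_eq_zero_iff two_ne_zero |>.1 this
    simp only [ha, mul_zero, Finset.sum_const_zero, abs_zero, Real.zero_rpow hp.ne']
    positivity
  -- normalize so that the coefficients have unit `ℓ²` norm
  set r := Real.sqrt s with hr
  have hr0 : 0 < r := Real.sqrt_pos.2 h0
  have hrs : r ^ 2 = s := Real.sq_sqrt hs0
  have hb : ∑ j, (a j / r) ^ 2 = 1 := by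
    simp_rw [div_pow, ← Finset.sum_div, hrs]
    exact div_self h0.ne'
  have hexp := sum_exp_sum_sign_le (fun j => a j / r)
  have hexp' := sum_exp_sum_sign_le (fun j => -(a j / r))
  simp_rw [neg_sq] at hexp'
  rw [hb] at hexp hexp'
  have hpt : ∀ ε : ι → ℤˣ, |∑ j, ((ε j : ℤ) : ℝ) * a j| ^ p ≤ r ^ p * ((⌈p⌉₊).factorial *
      (Real.exp (∑ j, ((ε j : ℤ) : ℝ) * (a j / r)) +
        Real.exp (∑ j, ((ε j : ℤ) : ℝ) * -(a j / r)))) := by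
    intro ε
    have e : ∑ j, ((ε j : ℤ) : ℝ) * a j = r * ∑ j, ((ε j : ℤ) : ℝ) * (a j / r) := by
      rw [Finset.mul_sum]
      refine Finset.sum_congr rfl fun j _ => ?_
      field_simp
    rw [e, abs_mul, Real.mul_rpow (abs_nonneg _) (abs_nonneg _), abs_of_pos hr0]
    refine mul_le_mul_of_nonneg_left ?_ (by positivity)
    simp_rw [mul_neg, Finset.sum_neg_distrib]
    exact abs_rpow_le_cosh hp.le _
  refine (Finset.sum_le_sum fun ε _ => hpt ε).trans ?_
  rw [← Finset.mul_sum, ← Finset.mul_sum, Finset.sum_add_distrib]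
  have e2 : r ^ p = s ^ (p / 2) := by
    rw [← hrs, ← Real.rpow_natCast, ← Real.rpow_mul hr0.le]
    congr 1
    push_cast; ring
  rw [e2]
  calc s ^ (p / 2) * ((⌈p⌉₊).factorial * _)
      ≤ s ^ (p / 2) * ((⌈p⌉₊).factorial * (Fintype.card (ι → ℤˣ) * Real.exp (1 / 2)
          + Fintype.card (ι → ℤˣ) * Real.exp (1 / 2))) := by
        gcongr
    _ = _ := by ring

lemma khintchine_upper [DecidableEq ι] {p : ℝ} (hp : 0 < p) (a : ι → ℂ) :
    ∑ ε : ι → ℤˣ, ‖∑ j, ((ε j : ℤ) : ℂ) * a j‖ ^ p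
      ≤ 2 ^ p * (2 * (2 * (⌈p⌉₊).factorial * Real.exp (1 / 2))) * Fintype.card (ι → ℤˣ)
        * (∑ j, ‖a j‖ ^ 2) ^ (p / 2) := by
  have hz : ∀ z : ℂ, ‖z‖ ^ p ≤ 2 ^ p * (|z.re| ^ p + |z.im| ^ p) := by
    intro z
    have h1 : ‖z‖ ≤ 2 * max |z.re| |z.im| := by
      linarith [Complex.norm_le_abs_re_add_abs_im z, le_max_left |z.re| |z.im|,
        le_max_right |z.re| |z.im|]
    calc ‖z‖ ^ p ≤ (2 * max |z.re| |z.im|) ^ p := by gcongr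
      _ = 2 ^ p * (max |z.re| |z.im|) ^ p := Real.mul_rpow (by norm_num) (by positivity)
      _ ≤ _ := by
        gcongr
        have := Real.rpow_nonneg (abs_nonneg z.re) p
        have := Real.rpow_nonneg (abs_nonneg z.im) p
        rcases max_cases |z.re| |z.im| with ⟨h, -⟩ | ⟨h, -⟩ <;> rw [h] <;> linarith
  have hre : (∑ j, (a j).re ^ 2) ^ (p / 2) ≤ (∑ j, ‖a j‖ ^ 2) ^ (p / 2) := by
    refine Real.rpow_le_rpow (by positivity) (Finset.sum_le_sum fun j _ => ?_) (by positivity)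
    exact sq_le_sq.2 ((Complex.abs_re_le_norm _).trans_eq (abs_norm _).symm)
  have him : (∑ j, (a j).im ^ 2) ^ (p / 2) ≤ (∑ j, ‖a j‖ ^ 2) ^ (p / 2) := by
    refine Real.rpow_le_rpow (by positivity) (Finset.sum_le_sum fun j _ => ?_) (by positivity)
    exact sq_le_sq.2 ((Complex.abs_im_le_norm _).trans_eq (abs_norm _).symm)
  have h1 := khintchine_upper_real hp (fun j => (a j).re)
  have h2 := khintchine_upper_real hp (fun j => (a j).im)
  set c := 2 * ((⌈p⌉₊).factorial : ℝ) * Real.exp (1 / 2)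
  have hc : 0 ≤ c := by positivity
  set N := (Fintype.card (ι → ℤˣ) : ℝ)
  have hN : 0 ≤ N := Nat.cast_nonneg _
  refine (Finset.sum_le_sum fun ε _ => hz _).trans ?_
  rw [← Finset.mul_sum, Finset.sum_add_distrib]
  simp_rw [re_sum_sign, im_sum_sign]
  calc _ ≤ 2 ^ p * (c * N * (∑ j, ‖a j‖ ^ 2) ^ (p / 2) + c * N * (∑ j, ‖a j‖ ^ 2) ^ (p / 2)) := by
        gcongr
        · exact h1.trans (by gcongr)
        · exact h2.trans (by gcongr)
    _ = _ := by ring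

lemma enorm_rpow_eq_ofReal {p : ℝ} (hp : 0 ≤ p) (z : ℂ) : ‖z‖ₑ ^ p = ENNReal.ofReal (‖z‖ ^ p) := by
  rw [← ofReal_norm, ENNReal.ofReal_rpow_of_nonneg (norm_nonneg _) hp]

lemma sum_enorm_sq_rpow_eq_ofReal {p : ℝ} (hp : 0 ≤ p) (a : ι → ℂ) :
    (∑ j, ‖a j‖ₑ ^ 2) ^ (p / 2) = ENNReal.ofReal ((∑ j, ‖a j‖ ^ 2) ^ (p / 2)) := by
  simp_rw [← ofReal_norm, ← ENNReal.ofReal_pow (norm_nonneg _)]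
  rw [← ENNReal.ofReal_sum_of_nonneg (fun _ _ => by positivity),
    ENNReal.ofReal_rpow_of_nonneg (by positivity) (by positivity)]

lemma khintchine_lower_enorm [DecidableEq ι] {p : ℝ} (hp : 2 ≤ p) (a : ι → ℂ) :
    Fintype.card (ι → ℤˣ) * (∑ j, ‖a j‖ₑ ^ 2) ^ (p / 2)
      ≤ ∑ ε : ι → ℤˣ, ‖∑ j, ((ε j : ℤ) : ℂ) * a j‖ₑ ^ p := by
  have hp0 : 0 ≤ p := by linarith
  simp_rw [enorm_rpow_eq_ofReal hp0]
  rw [sum_enorm_sq_rpow_eq_ofReal hp0, ← ENNReal.ofReal_sum_of_nonneg (fun _ _ => by positivity),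
    ← ENNReal.ofReal_natCast, ← ENNReal.ofReal_mul (by positivity)]
  exact ENNReal.ofReal_le_ofReal (khintchine_lower hp a)

lemma exists_khintchine_upper_enorm {p : ℝ} (hp : 0 < p) :
    ∃ C : ℝ≥0, ∀ (ι : Type) [Fintype ι] [DecidableEq ι] (a : ι → ℂ),
      ∑ ε : ι → ℤˣ, ‖∑ j, ((ε j : ℤ) : ℂ) * a j‖ₑ ^ p
        ≤ C * Fintype.card (ι → ℤˣ) * (∑ j, ‖a j‖ₑ ^ 2) ^ (p / 2) := by
  refine ⟨(2 ^ p * (2 * (2 * (⌈p⌉₊).factorial * Real.exp (1 / 2)))).toNNReal, fun ι _ _ a => ?_⟩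
  simp_rw [enorm_rpow_eq_ofReal hp.le]
  rw [sum_enorm_sq_rpow_eq_ofReal hp.le, ← ENNReal.ofReal_sum_of_nonneg (fun _ _ => by positivity),
    ← ENNReal.ofReal_natCast, ← ENNReal.ofReal, ← ENNReal.ofReal_mul (by positivity),
    ← ENNReal.ofReal_mul (by positivity)]
  exact ENNReal.ofReal_le_ofReal (khintchine_upper hp a)

end Khintchine

/-! ### Modulations, translations and Plancherel's theorem -/

lemma fourierInv_comp_sub (h : ℝ → ℂ) (η x : ℝ) :
    𝓕⁻ (fun ξ => h (ξ - η)) x = 𝐞 (η * x) * 𝓕⁻ h x := by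
  rw [fourierInv_real_eq, fourierInv_real_eq, ← integral_const_mul,
    ← integral_sub_right_eq_self (fun v => (𝐞 (η * x) : ℂ) * ((𝐞 (v * x) : ℂ) * h v)) η]
  congr 1; ext v
  rw [← mul_assoc, ← Circle.coe_mul, ← AddChar.map_add_eq_mul]
  congr 3
  ring_nf

lemma fourierInv_char_mul (h : ℝ → ℂ) (t x : ℝ) :
    𝓕⁻ (fun ξ => (𝐞 (-(t * ξ)) : ℂ) * h ξ) x = 𝓕⁻ h (x - t) := by
  rw [fourierInv_real_eq, fourierInv_real_eq]
  congr 1; ext v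
  rw [← mul_assoc, ← Circle.coe_mul, ← AddChar.map_add_eq_mul]
  congr 3
  ring_nf

lemma continuous_char_coe {f : ℝ → ℝ} (hf : Continuous f) : Continuous fun ξ => (𝐞 (f ξ) : ℂ) :=
  continuous_subtype_val.comp (Real.continuous_fourierChar.comp hf)

lemma contDiff_char_coe {f : ℝ → ℝ} {n : ℕ∞} (hf : ContDiff ℝ n f) :
    ContDiff ℝ n fun ξ => (𝐞 (f ξ) : ℂ) := by
  simp_rw [Real.fourierChar_apply]
  exact ((Complex.ofRealCLM.contDiff.comp (contDiff_const.mul hf)).mul contDiff_const).cexp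

lemma norm_char (t : ℝ) : ‖(𝐞 t : ℂ)‖ = 1 := Circle.norm_coe _

lemma integrable_char_mul {h : ℝ → ℂ} (hh : Integrable h) {f : ℝ → ℝ} (hf : Continuous f) :
    Integrable fun ξ => (𝐞 (f ξ) : ℂ) * h ξ :=
  hh.bdd_mul (c := 1) (continuous_char_coe hf).aestronglyMeasurable
    (Filter.Eventually.of_forall fun _ => (norm_char _).le)

lemma fourierInv_finset_sum {κ : Type*} (s : Finset κ) (c : κ → ℂ) {g : κ → ℝ → ℂ}
    (hg : ∀ i ∈ s, Integrable (g i)) (x : ℝ) :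
    𝓕⁻ (fun ξ => ∑ i ∈ s, c i * g i ξ) x = ∑ i ∈ s, c i * 𝓕⁻ (g i) x := by
  simp_rw [fourierInv_real_eq, Finset.mul_sum]
  rw [integral_finsetSum]
  · refine Finset.sum_congr rfl fun i _ => ?_
    rw [← integral_const_mul]
    congr 1; ext v
    ring
  · intro i hi
    exact integrable_char_mul ((hg i hi).const_mul (c i)) (by fun_prop)

/-- Multiplication by a trigonometric polynomial on the Fourier side is a combination of
translations. -/
lemma fourierInv_trigPoly_mul (s : Finset ℤ) (a : ℤ → ℂ) {h : ℝ → ℂ} (hh : Integrable h) (x : ℝ) :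
    𝓕⁻ (fun ξ => (∑ n ∈ s, a n * (𝐞 (-(n * ξ)) : ℂ)) * h ξ) x = ∑ n ∈ s, a n * 𝓕⁻ h (x - n) := by
  have := fourierInv_finset_sum s a (g := fun n ξ => (𝐞 (-((n : ℝ) * ξ)) : ℂ) * h ξ)
    (fun n _ => integrable_char_mul hh (by fun_prop)) x
  simp_rw [fourierInv_char_mul] at this
  rw [← this]
  refine congrArg (fun g : ℝ → ℂ => 𝓕⁻ g x) (funext fun ξ => ?_)
  rw [Finset.sum_mul]
  simp_rw [mul_assoc]

lemma hasCompactSupport_of_forall_lt_abs {h : ℝ → ℂ} {R : ℝ} (hs : ∀ ξ, R < |ξ| → h ξ = 0) :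
    HasCompactSupport h := by
  refine HasCompactSupport.intro (isCompact_Icc (a := -R) (b := R)) fun ξ hξ => hs ξ ?_
  rw [← not_le, abs_le]
  exact hξ

lemma lintegral_enorm_sq_fourierInv (f : 𝓢(ℝ, ℂ)) :
    ∫⁻ x, ‖𝓕⁻ (f : ℝ → ℂ) x‖ₑ ^ 2 = ENNReal.ofReal (∫ x, ‖f x‖ ^ 2) := by
  have h := SchwartzMap.integral_norm_sq_fourier (𝓕⁻ f)
  rw [FourierTransform.fourier_fourierInv_eq] at h
  have hI : Integrable fun x => ‖(𝓕⁻ f) x‖ ^ 2 :=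
    ((𝓕⁻ f).memLp 2).integrable_norm_pow (by norm_num)
  rw [h, ofReal_integral_eq_lintegral_ofReal hI (Filter.Eventually.of_forall fun x => by positivity),
    ← SchwartzMap.fourierInv_coe]
  congr 1; ext x
  rw [ENNReal.ofReal_pow (norm_nonneg _), ofReal_norm]

/-! ### The large sieve for separated frequencies -/

/-- Bessel's inequality on `ℤ` for modulated bumps with disjoint spectra: orthogonality on `ℝ` is
transferred to `ℤ` by sampling. -/
lemma exists_bessel : ∃ C : ℝ≥0, ∀ δ : ℝ, 0 < δ → δ ≤ 1 → ∀ (ι : Type) [Fintype ι]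
    (ξ : ι → ℝ), (∀ j, |ξ j| ≤ 1 / 2) → (∀ i j, i ≠ j → δ ≤ |ξ i - ξ j|) →
    ∀ h : ℝ → ℂ, ContDiff ℝ (⊤ : ℕ∞) h → (∀ t, δ / 2 ≤ |t| → h t = 0) →
    ∀ (c : ι → ℂ) (x : ℝ) (s : Finset ℤ),
      ∑ n ∈ s, ‖∑ j, c j * (𝐞 (ξ j * n) : ℂ) * 𝓕⁻ h (n - x)‖ ^ 2
        ≤ C * (∑ j, ‖c j‖ ^ 2) * ∫ t, ‖h t‖ ^ 2 := by
  classical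
  obtain ⟨C, hC⟩ := exists_sampling one_le_two
  refine ⟨C, fun δ hδ hδ1 ι _ ξ hξ hsep h hsm hh c x s => ?_⟩
  have hcs : HasCompactSupport h := hasCompactSupport_of_forall_lt_abs fun t ht => hh t ht.le
  have hint : Integrable h := hsm.continuous.integrable_of_hasCompactSupport hcs
  -- the spectral side of `y ↦ ∑ j, c j * 𝐞 (ξ j * y) * 𝓕⁻ h (y - x)`
  let g : ι → ℝ → ℂ := fun j t => (𝐞 (-(x * (t - ξ j))) : ℂ) * h (t - ξ j)
  let u : ℝ → ℂ := fun t => ∑ j, c j * g j t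
  have hg : ∀ j, Integrable (g j) := fun j =>
    integrable_char_mul (hint.comp_sub_right (ξ j)) (by fun_prop)
  have hu : ∀ y, 𝓕⁻ u y = ∑ j, c j * (𝐞 (ξ j * y) : ℂ) * 𝓕⁻ h (y - x) := by
    intro y
    rw [fourierInv_finset_sum Finset.univ c (fun j _ => hg j)]
    refine Finset.sum_congr rfl fun j _ => ?_
    have := fourierInv_comp_sub (fun t => (𝐞 (-(x * t)) : ℂ) * h t) (ξ j) y
    rw [fourierInv_char_mul] at this
    rw [mul_assoc, ← this]
  have hus : ∀ t, 1 < |t| → u t = 0 := by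
    intro t ht
    refine Finset.sum_eq_zero fun j _ => ?_
    have : δ / 2 ≤ |t - ξ j| := by
      have := abs_sub_abs_le_abs_sub t (ξ j)
      linarith [hξ j]
    simp [g, hh _ this]
  have husm : ContDiff ℝ (⊤ : ℕ∞) u := by
    refine ContDiff.sum fun j _ => contDiff_const.mul (ContDiff.mul ?_ ?_)
    · exact contDiff_char_coe (by fun_prop)
    · exact hsm.comp (by fun_prop)
  have hucs : HasCompactSupport u := hasCompactSupport_of_forall_lt_abs hus
  have huint : Integrable u := husm.continuous.integrable_of_hasCompactSupport hucs
  -- at most one of the summands of `u` is nonzero at each point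
  have hnorm : ∀ t, ‖u t‖ ^ 2 = ∑ j, ‖c j‖ ^ 2 * ‖h (t - ξ j)‖ ^ 2 := by
    intro t
    by_cases hex : ∃ j, h (t - ξ j) ≠ 0
    · obtain ⟨j, hj⟩ := hex
      have hother : ∀ i, i ≠ j → h (t - ξ i) = 0 := by
        intro i hij
        by_contra hi
        have h1 : |t - ξ j| < δ / 2 := by
          by_contra hlt; exact hj (hh _ (not_lt.1 hlt))
        have h2 : |t - ξ i| < δ / 2 := by
          by_contra hlt; exact hi (hh _ (not_lt.1 hlt))
        have h3 := hsep i j hij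
        have h4 : |ξ i - ξ j| ≤ |t - ξ j| + |t - ξ i| := by
          have : ξ i - ξ j = (t - ξ j) - (t - ξ i) := by ring
          rw [this]; exact abs_sub _ _
        linarith
      have e1 : u t = c j * g j t :=
        Finset.sum_eq_single j (fun i _ hij => by simp [g, hother i hij]) (by simp)
      rw [e1, Finset.sum_eq_single j (fun i _ hij => by simp [hother i hij]) (by simp)]
      simp only [g, norm_mul, norm_char, one_mul, mul_pow]
    · push Not at hex
      simp [u, g, hex]
  have hhsq : Integrable fun t => ‖h t‖ ^ 2 :=
    (hsm.continuous.memLp_of_hasCompactSupport (p := 2) hcs).integrable_norm_pow (by norm_num)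
  have hL2 : ∫ t, ‖u t‖ ^ 2 = (∑ j, ‖c j‖ ^ 2) * ∫ t, ‖h t‖ ^ 2 := by
    simp_rw [hnorm]
    rw [integral_finsetSum _ fun j _ => (hhsq.comp_sub_right (ξ j)).const_mul _, Finset.sum_mul]
    refine Finset.sum_congr rfl fun j _ => ?_
    rw [integral_const_mul, integral_sub_right_eq_self (fun t => ‖h t‖ ^ 2) (ξ j)]
  have hP := lintegral_enorm_sq_fourierInv (hucs.toSchwartzMap husm)
  have hS := hC u huint hus
  simp only [ENNReal.rpow_ofNat] at hS
  have hP' : ∫⁻ y, ‖𝓕⁻ u y‖ₑ ^ 2 = ENNReal.ofReal (∫ t, ‖u t‖ ^ 2) := hP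
  rw [hP', hL2] at hS
  have hfin : ENNReal.ofReal (∑ n ∈ s, ‖𝓕⁻ u n‖ ^ 2) ≤ ∑' n : ℤ, ‖𝓕⁻ u n‖ₑ ^ 2 := by
    rw [ENNReal.ofReal_sum_of_nonneg fun _ _ => by positivity]
    simp_rw [ENNReal.ofReal_pow (norm_nonneg _), ofReal_norm]
    exact ENNReal.sum_le_tsum s
  have := hfin.trans hS
  rw [← ENNReal.ofReal_coe_nnreal, ← ENNReal.ofReal_mul C.coe_nonneg, ENNReal.ofReal_le_ofReal_iff
    (mul_nonneg C.coe_nonneg (mul_nonneg (by positivity)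
      (integral_nonneg fun t => by positivity)))] at this
  simp_rw [hu] at this
  rw [mul_assoc]
  exact this

lemma fourierInv_deriv {h : ℝ → ℂ} (hsm : ContDiff ℝ (⊤ : ℕ∞) h) (hcs : HasCompactSupport h) (y : ℝ) :
    𝓕⁻ (deriv h) y = -(2 * Real.pi * Complex.I * y) * 𝓕⁻ h y := by
  have hd : Continuous (deriv h) := hsm.continuous_deriv (by norm_cast)
  rw [Real.fourierInv_eq_fourier_neg, Real.fourierInv_eq_fourier_neg, Real.fourier_deriv
    (hsm.continuous.integrable_of_hasCompactSupport hcs) (hsm.differentiable (by simp))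
    (hd.integrable_of_hasCompactSupport hcs.deriv)]
  simp

/-- The weighted form of Bessel's inequality for dilates of a fixed bump: multiplication by the
weight is differentiation on the spectral side, which keeps the spectra disjoint. -/
lemma exists_weighted_bessel {φ : ℝ → ℂ} (hsm : ContDiff ℝ (⊤ : ℕ∞) φ)
    {R : ℝ} (hR : R < 1 / 2) (hφ : ∀ t, R ≤ |t| → φ t = 0) :
    ∃ C : ℝ≥0, ∀ δ : ℝ, 0 < δ → δ ≤ 1 → ∀ (ι : Type) [Fintype ι]
      (ξ : ι → ℝ), (∀ j, |ξ j| ≤ 1 / 2) → (∀ i j, i ≠ j → δ ≤ |ξ i - ξ j|) →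
      ∀ (c : ι → ℂ) (x : ℝ) (s : Finset ℤ),
        ∑ n ∈ s, (1 + (δ * (x - n)) ^ 2) *
            ‖∑ j, c j * (𝐞 (ξ j * n) : ℂ) * 𝓕⁻ (fun t => φ (t / δ)) (n - x)‖ ^ 2
          ≤ C * δ * ∑ j, ‖c j‖ ^ 2 := by
  obtain ⟨C, hC⟩ := exists_bessel
  have hd0 : ∀ t, 1 / 2 ≤ |t| → deriv φ t = 0 := by
    intro t ht
    have : φ =ᶠ[nhds t] fun _ => 0 := by
      filter_upwards [continuous_abs.continuousAt.eventually_const_lt (hR.trans_le ht)] with y hy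
      exact hφ y hy.le
    rw [this.deriv_eq, deriv_const]
  have hφ0 : ∀ t, 1 / 2 ≤ |t| → φ t = 0 := fun t ht => hφ t (hR.le.trans ht)
  have hdsm : ContDiff ℝ (⊤ : ℕ∞) (deriv φ) := by
    have := hsm
    rw [show ((⊤ : ℕ∞) : WithTop ℕ∞) = (⊤ : ℕ∞) + 1 by rfl, contDiff_succ_iff_deriv] at this
    exact this.2.2
  refine ⟨C * ((∫ t, ‖φ t‖ ^ 2) + ∫ t, ‖deriv φ t‖ ^ 2).toNNReal,
    fun δ hδ hδ1 ι _ ξ hξ hsep c x s => ?_⟩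
  have hscale : ∀ ψ : ℝ → ℂ, (∀ t, 1 / 2 ≤ |t| → ψ t = 0) → ∀ t, δ / 2 ≤ |t| → ψ (t / δ) = 0 := by
    intro ψ hψ t ht
    refine hψ _ ?_
    rw [abs_div, abs_of_pos hδ, le_div_iff₀ hδ]
    linarith
  have hsm1 : ∀ ψ : ℝ → ℂ, ContDiff ℝ (⊤ : ℕ∞) ψ → ContDiff ℝ (⊤ : ℕ∞) fun t => ψ (t / δ) :=
    fun ψ hψ => hψ.comp (by fun_prop)
  have hcs : HasCompactSupport fun t => φ (t / δ) :=
    hasCompactSupport_of_forall_lt_abs fun t ht => hscale φ hφ0 t ht.le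
  have hderiv : deriv (fun t => φ (t / δ)) = fun t => (δ : ℂ)⁻¹ * deriv φ (t / δ) := by
    ext t
    simp_rw [div_eq_inv_mul]
    rw [deriv_comp_mul_left δ⁻¹ φ t]
    simp
  have hL2 : ∀ ψ : ℝ → ℂ, ∫ t, ‖ψ (t / δ)‖ ^ 2 = δ * ∫ t, ‖ψ t‖ ^ 2 := fun ψ => by
    have := Measure.integral_comp_div (fun t => ‖ψ t‖ ^ 2) δ
    rwa [abs_of_pos hδ, smul_eq_mul] at this
  have b1 := hC δ hδ hδ1 ι ξ hξ hsep _ (hsm1 φ hsm) (hscale φ hφ0) c x s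
  have b2 := hC δ hδ hδ1 ι ξ hξ hsep _ (hsm1 _ hdsm) (hscale _ hd0) c x s
  rw [hL2] at b1 b2
  have hF : ∀ y, 𝓕⁻ (fun t => deriv φ (t / δ)) y
      = -(2 * Real.pi * Complex.I * (δ * y)) * 𝓕⁻ (fun t => φ (t / δ)) y := by
    intro y
    have h1 := fourierInv_deriv (hsm1 φ hsm) hcs y
    rw [hderiv, fourierInv_real_eq] at h1
    rw [fourierInv_real_eq]
    simp_rw [mul_left_comm _ (δ : ℂ)⁻¹] at h1
    rw [integral_const_mul, inv_mul_eq_iff_eq_mul₀ (by exact_mod_cast hδ.ne')] at h1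
    rw [h1]
    ring
  have hpt : ∀ n : ℤ, (1 + (δ * (x - n)) ^ 2) *
        ‖∑ j, c j * (𝐞 (ξ j * n) : ℂ) * 𝓕⁻ (fun t => φ (t / δ)) (n - x)‖ ^ 2
      ≤ ‖∑ j, c j * (𝐞 (ξ j * n) : ℂ) * 𝓕⁻ (fun t => φ (t / δ)) (n - x)‖ ^ 2 +
        ‖∑ j, c j * (𝐞 (ξ j * n) : ℂ) * 𝓕⁻ (fun t => deriv φ (t / δ)) (n - x)‖ ^ 2 := by
    intro n
    simp_rw [hF, mul_left_comm _ (-(2 * Real.pi * Complex.I * _))]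
    have hpi : 1 ≤ (2 * Real.pi) ^ 2 := one_le_pow₀ (by linarith [Real.pi_gt_three])
    have hfac : ‖-(2 * Real.pi * Complex.I * (δ * ((n : ℝ) - x : ℝ)))‖ ^ 2
        = (2 * Real.pi) ^ 2 * (δ * (x - n)) ^ 2 := by
      simp only [norm_neg, norm_mul, Complex.norm_I, Complex.norm_real, mul_pow, Real.norm_eq_abs,
        sq_abs, Complex.norm_ofNat]
      ring
    rw [← Finset.mul_sum, norm_mul]
    generalize ‖∑ j, c j * (𝐞 (ξ j * n) : ℂ) * 𝓕⁻ (fun t => φ (t / δ)) (n - x)‖ = V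
    rw [mul_pow _ V, hfac, ← one_add_mul]
    gcongr
    exact le_mul_of_one_le_left (sq_nonneg _) hpi
  refine (Finset.sum_le_sum fun n _ => hpt n).trans ?_
  rw [Finset.sum_add_distrib]
  refine (add_le_add b1 b2).trans_eq ?_
  have h1 : 0 ≤ ∫ t, ‖φ t‖ ^ 2 := integral_nonneg fun t => by positivity
  have h2 : 0 ≤ ∫ t, ‖deriv φ t‖ ^ 2 := integral_nonneg fun t => by positivity
  rw [NNReal.coe_mul, Real.coe_toNNReal _ (add_nonneg h1 h2)]
  ring

/-- **Large sieve inequality** for smooth averages at scale `1 / δ` of the modulations of `f` by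
`δ`-separated frequencies, by duality from Bessel's inequality. -/
lemma exists_large_sieve {φ : ℝ → ℂ} (hsm : ContDiff ℝ (⊤ : ℕ∞) φ)
    {R : ℝ} (hR : R < 1 / 2) (hφ : ∀ t, R ≤ |t| → φ t = 0) (heven : ∀ t, φ (-t) = φ t) :
    ∃ C : ℝ≥0, ∀ δ : ℝ, 0 < δ → δ ≤ 1 → ∀ (ι : Type) [Fintype ι]
      (ξ : ι → ℝ), (∀ j, |ξ j| ≤ 1 / 2) → (∀ i j, i ≠ j → δ ≤ |ξ i - ξ j|) →
      ∀ (f : ℤ → ℂ) (s : Finset ℤ) (x : ℝ),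
        ∑ j, ‖∑ n ∈ s, f n * (𝐞 (-(ξ j * n)) : ℂ) * 𝓕⁻ (fun t => φ (t / δ)) (x - n)‖ₑ ^ 2
          ≤ C * ∑ n ∈ s, cauchyKernel δ x n * ‖f n‖ₑ ^ 2 := by
  obtain ⟨C, hC⟩ := exists_weighted_bessel hsm hR hφ
  refine ⟨C, fun δ hδ hδ1 ι _ ξ hξ hsep f s x => ?_⟩
  set Φ := 𝓕⁻ (fun t => φ (t / δ)) with hΦ
  have hΦeven : ∀ y, Φ (-y) = Φ y := by
    intro y
    rw [hΦ, Real.fourierInv_eq_fourier_neg, neg_neg, Real.fourierInv_eq_fourier_comp_neg]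
    simp_rw [neg_div, heven]
  set G : ι → ℂ := fun j => ∑ n ∈ s, f n * (𝐞 (-(ξ j * n)) : ℂ) * Φ (x - n) with hG
  set U : ℤ → ℂ := fun n => ∑ j, star (G j) * (𝐞 (-ξ j * n) : ℂ) * Φ (n - x) with hU
  have hb : ∑ n ∈ s, (1 + (δ * (x - n)) ^ 2) * ‖U n‖ ^ 2 ≤ C * δ * ∑ j, ‖G j‖ ^ 2 := by
    have := hC δ hδ hδ1 ι (fun j => -ξ j) (fun j => by simpa using hξ j)
      (fun i j hij => by rw [neg_sub_neg, abs_sub_comm]; exact hsep i j hij) (fun j => star (G j)) x s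
    simpa only [norm_star] using this
  set Q := ∑ j, ‖G j‖ ^ 2 with hQ
  have hQ0 : 0 ≤ Q := by positivity
  have hdual : (Q : ℂ) = ∑ n ∈ s, f n * U n := by
    calc (Q : ℂ) = ∑ j, star (G j) * G j := by
          rw [hQ, Complex.ofReal_sum]
          refine Finset.sum_congr rfl fun j _ => ?_
          rw [Complex.ofReal_pow]
          exact (Complex.conj_mul' (G j)).symm
      _ = ∑ j, ∑ n ∈ s, f n * (star (G j) * (𝐞 (-ξ j * n) : ℂ) * Φ (n - x)) := by
          refine Finset.sum_congr rfl fun j _ => ?_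
          conv_lhs => rw [hG]
          simp only
          rw [Finset.mul_sum]
          refine Finset.sum_congr rfl fun n _ => ?_
          rw [← hΦeven (n - x), neg_sub, neg_mul]
          ring
      _ = _ := by
          rw [Finset.sum_comm]
          simp_rw [hU, Finset.mul_sum]
  set W := ∑ n ∈ s, δ / (1 + (δ * (x - n)) ^ 2) * ‖f n‖ ^ 2 with hW
  have hcs : Q ^ 2 ≤ W * (C * Q) := by
    have h1 : Q ≤ ∑ n ∈ s, ‖f n‖ * ‖U n‖ := by
      have : ‖(Q : ℂ)‖ = Q := by rw [Complex.norm_real, Real.norm_of_nonneg hQ0]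
      rw [← this, hdual]
      refine (norm_sum_le _ _).trans_eq ?_
      simp_rw [norm_mul]
    have h2 : (∑ n ∈ s, ‖f n‖ * ‖U n‖) ^ 2
        ≤ W * ∑ n ∈ s, δ⁻¹ * ((1 + (δ * (x - n)) ^ 2) * ‖U n‖ ^ 2) := by
      refine Finset.sum_sq_le_sum_mul_sum_of_sq_le_mul s (fun n _ => by positivity)
        (fun n _ => by positivity) fun n _ => ?_
      have : (1 + (δ * (x - n)) ^ 2) ≠ 0 := by positivity
      refine le_of_eq ?_
      field_simp
    rw [← Finset.mul_sum] at h2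
    have hW0 : 0 ≤ W := by positivity
    calc Q ^ 2 ≤ (∑ n ∈ s, ‖f n‖ * ‖U n‖) ^ 2 := by gcongr
      _ ≤ _ := h2
      _ ≤ W * (δ⁻¹ * (C * δ * Q)) := by gcongr
      _ = W * (C * Q) := by field_simp
  have hQW : Q ≤ C * W := by
    rcases hQ0.eq_or_lt with h0 | h0
    · rw [← h0]; positivity
    · refine le_of_mul_le_mul_right ?_ h0
      linarith
  have e1 : ∑ j, ‖G j‖ₑ ^ 2 = ENNReal.ofReal Q := by
    rw [hQ, ENNReal.ofReal_sum_of_nonneg fun _ _ => by positivity]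
    simp_rw [ENNReal.ofReal_pow (norm_nonneg _), ofReal_norm]
  have e2 : ∑ n ∈ s, cauchyKernel δ x n * ‖f n‖ₑ ^ 2 = ENNReal.ofReal W := by
    rw [hW, ENNReal.ofReal_sum_of_nonneg fun _ _ => by positivity]
    refine Finset.sum_congr rfl fun n _ => ?_
    rw [ENNReal.ofReal_mul (by positivity), ENNReal.ofReal_pow (norm_nonneg _), ofReal_norm,
      cauchyKernel]
  rw [e1, e2, ← ENNReal.ofReal_coe_nnreal, ← ENNReal.ofReal_mul C.coe_nonneg]
  exact ENNReal.ofReal_le_ofReal hQW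

/-! ### The square function of finitely supported sequences -/

lemma IsLpMultiplier.integrable {p : ℝ≥0∞} {A : ℝ≥0} {m : ℝ → ℂ} (hm : IsLpMultiplier p A m)
    {R : ℝ} (hs : ∀ ξ, R < |ξ| → m ξ = 0) : Integrable m := by
  obtain ⟨B, hB⟩ := hm.bounded
  have h : IntegrableOn m (Set.Icc (-R) R) :=
    Measure.integrableOn_of_bounded (M := B) measure_Icc_lt_top.ne
      hm.aemeasurable.aestronglyMeasurable (Filter.Eventually.of_forall fun ξ => hB ξ)
  refine h.integrable_of_forall_notMem_eq_zero fun ξ hξ => hs ξ ?_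
  rwa [← not_le, abs_le]

/-- **Transference** from `ℝ` to `ℤ`: a sequence `a` is extended to the band-limited function
`x ↦ ∑ a k φ^∨(x - k)`, on which the operator with multiplier `m` acts by replacing `φ^∨` by the
kernel of `m`, since `m φ = m`; the result is then sampled at the integers. -/
lemma exists_transference {q : ℝ≥0} (hq : 1 ≤ q) : ∃ C : ℝ≥0, ∀ (A : ℝ≥0) (m φ : ℝ → ℂ),
    IsLpMultiplier q A m → ContDiff ℝ (⊤ : ℕ∞) φ → (∀ ξ, 1 < |ξ| → φ ξ = 0) →
    (∀ ξ, m ξ * φ ξ = m ξ) → ∀ (a : ℤ → ℂ) (s : Finset ℤ),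
      ∑' n : ℤ, ‖∑ k ∈ s, a k * kernel m (n - k)‖ₑ ^ (q : ℝ)
        ≤ C * A ^ (q : ℝ) * ∫⁻ x, ‖∑ k ∈ s, a k * 𝓕⁻ φ (x - k)‖ₑ ^ (q : ℝ) := by
  obtain ⟨C, hC⟩ := exists_sampling (p := (q : ℝ)) (by exact_mod_cast hq)
  refine ⟨C, fun A m φ hm hsm hφ hmφ a s => ?_⟩
  have hms : ∀ ξ, 1 < |ξ| → m ξ = 0 := fun ξ hξ => by rw [← hmφ, hφ ξ hξ, mul_zero]
  have hmint : Integrable m := hm.integrable hms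
  have hcs : HasCompactSupport φ := hasCompactSupport_of_forall_lt_abs hφ
  have hφint : Integrable φ := hsm.continuous.integrable_of_hasCompactSupport hcs
  let t : ℝ → ℂ := fun ξ => ∑ k ∈ s, a k * (𝐞 (-(k * ξ)) : ℂ)
  let g : ℝ → ℂ := fun ξ => t ξ * φ ξ
  have htsm : ContDiff ℝ (⊤ : ℕ∞) t :=
    ContDiff.sum fun k _ => contDiff_const.mul (contDiff_char_coe (by fun_prop))
  have hgsm : ContDiff ℝ (⊤ : ℕ∞) g := htsm.mul hsm
  have hgcs : HasCompactSupport g := hcs.mul_left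
  let F : 𝓢(ℝ, ℂ) := 𝓕⁻ (hgcs.toSchwartzMap hgsm)
  have hF : 𝓕 (F : ℝ → ℂ) = g := by
    rw [← SchwartzMap.fourier_coe, FourierTransform.fourier_fourierInv_eq]
    rfl
  have hFx : ∀ x, F x = ∑ k ∈ s, a k * 𝓕⁻ φ (x - k) := by
    intro x
    rw [← fourierInv_trigPoly_mul s a hφint x, SchwartzMap.fourierInv_coe]
    rfl
  have hmg : (fun ξ => m ξ * 𝓕 (F : ℝ → ℂ) ξ) = fun ξ => t ξ * m ξ := by
    ext ξ
    rw [hF, mul_left_comm, hmφ]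
  have hH : ∀ x, 𝓕⁻ (fun ξ => t ξ * m ξ) x = ∑ k ∈ s, a k * kernel m (x - k) :=
    fun x => fourierInv_trigPoly_mul s a hmint x
  have htm : Integrable fun ξ => t ξ * m ξ := by
    have : (fun ξ => t ξ * m ξ) = fun ξ => ∑ k ∈ s, a k * ((𝐞 (-((k : ℝ) * ξ)) : ℂ) * m ξ) := by
      ext ξ
      simp only [t, Finset.sum_mul, mul_assoc]
    rw [this]
    exact integrable_finsetSum _ fun k _ =>
      (integrable_char_mul hmint (f := fun ξ => -((k : ℝ) * ξ)) (by fun_prop)).const_mul _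
  have hS := hC _ htm fun ξ hξ => by rw [hms ξ hξ, mul_zero]
  have hq0 : q ≠ 0 := (zero_lt_one.trans_le hq).ne'
  have hN := ENNReal.rpow_le_rpow (hm.norm_le F) q.coe_nonneg
  rw [ENNReal.mul_rpow_of_nonneg _ _ q.coe_nonneg, eLpNorm_nnreal_pow_eq_lintegral hq0,
    eLpNorm_nnreal_pow_eq_lintegral hq0, hmg] at hN
  simp_rw [hFx] at hN
  simp_rw [hH] at hS hN
  rw [mul_assoc]
  exact hS.trans (by gcongr)

/-- Schur's test for averages of finitely supported sequences against the Cauchy kernel. -/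
lemma lintegral_sum_cauchyKernel_rpow_le {r : ℝ} (hr : 1 ≤ r) {δ : ℝ} (hδ : 0 < δ) (hδ1 : δ ≤ 1)
    (f : ℤ → ℝ≥0∞) (s : Finset ℤ) :
    ∫⁻ x, (∑ n ∈ s, cauchyKernel δ x n * f n) ^ r
      ≤ (3 * ENNReal.ofReal Real.pi) ^ (r - 1) * ENNReal.ofReal Real.pi * ∑ n ∈ s, f n ^ r := by
  have hr0 : 0 < r := by linarith
  let k : ℝ → ℤ → ℝ≥0∞ := fun x n => cauchyKernel δ x n
  have hk : Measurable (Function.uncurry k) := by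
    have hcast : Measurable fun z : ℝ × ℤ => (z.1, (z.2 : ℝ)) :=
      measurable_fst.prodMk ((measurable_of_countable (fun n : ℤ => (n : ℝ))).comp measurable_snd)
    have h := (measurable_cauchyKernel δ).comp hcast
    exact h
  have key := lintegral_schur (μ := volume) (ν := Measure.count) hr hk
    (f := fun n => if n ∈ s then f n else 0) (measurable_of_countable _)
    (A := 3 * ENNReal.ofReal Real.pi) (B := ENNReal.ofReal Real.pi)
    (fun x => by rw [lintegral_count]; exact tsum_cauchyKernel_le hδ hδ1 x)
    (fun n => by
      simp_rw [k, cauchyKernel_comm δ _ (n : ℝ)]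
      exact (lintegral_cauchyKernel hδ n).le)
  have e1 : ∀ x, ∫⁻ n, k x n * (if n ∈ s then f n else 0) ∂Measure.count
      = ∑ n ∈ s, cauchyKernel δ x n * f n := by
    intro x
    rw [lintegral_count, tsum_eq_sum (s := s) fun n hn => by simp [hn]]
    exact Finset.sum_congr rfl fun n hn => by simp [hn, k]
  have e2 : ∫⁻ n, (if n ∈ s then f n else 0) ^ r ∂Measure.count = ∑ n ∈ s, f n ^ r := by
    rw [lintegral_count, tsum_eq_sum (s := s) fun n hn => by simp [hn, hr0]]
    exact Finset.sum_congr rfl fun n hn => by simp [hn]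
  simp_rw [e1] at key
  rwa [e2] at key

/-- The square function estimate for finitely supported sequences, with the operators written as
convolutions of `kernel m` with modulations of `f`. -/
lemma exists_squareFunction_bound_of_finite {q : ℝ≥0} (hq : 2 ≤ q) {c : ℝ} (hc0 : 0 < c)
    (hc : c < 1 / 2) (A : ℝ≥0) :
    ∃ C : ℝ≥0, ∀ δ : ℝ, 0 < δ → δ ≤ 1 → ∀ m : ℝ → ℂ, IsLpMultiplier q A m →
      (∀ ξ, c * δ < |ξ| → m ξ = 0) → ∀ (ι : Type) [Fintype ι]
      (ξ : ι → ℝ), (∀ j, |ξ j| ≤ 1 / 2) → (∀ i j, i ≠ j → δ ≤ |ξ i - ξ j|) →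
      ∀ (f : ℤ → ℂ) (s : Finset ℤ),
        ∑' n : ℤ, (∑ j, ‖∑ k ∈ s, f k * (𝐞 (-(ξ j * k)) : ℂ) * kernel m (n - k)‖ₑ ^ 2)
            ^ ((q : ℝ) / 2)
          ≤ C * ∑ k ∈ s, ‖f k‖ₑ ^ (q : ℝ) := by
  classical
  have hqR : (2 : ℝ) ≤ q := by exact_mod_cast hq
  have hq0 : (0 : ℝ) ≤ q := q.coe_nonneg
  have hq2 : 0 ≤ (q : ℝ) / 2 := by positivity
  have hq21 : 1 ≤ (q : ℝ) / 2 := by linarith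
  obtain ⟨χ, hχ1, hχ0, hχe⟩ := exists_smooth_cutoff hc0 (show c < (c + 1 / 2) / 2 by linarith)
  have hχR : (c + 1 / 2) / 2 < 1 / 2 := by linarith
  have hχsm : ContDiff ℝ (⊤ : ℕ∞) χ := χ.smooth _
  obtain ⟨C₁, hC₁⟩ := exists_transference (q := q) (one_le_two.trans hq)
  obtain ⟨C₂, hC₂⟩ := exists_khintchine_upper_enorm (p := (q : ℝ)) (by linarith)
  obtain ⟨C₃, hC₃⟩ := exists_large_sieve hχsm hχR hχ0 hχe
  let C₄ : ℝ≥0∞ := (3 * ENNReal.ofReal Real.pi) ^ ((q : ℝ) / 2 - 1) * ENNReal.ofReal Real.pi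
  have hC₄ : C₄ ≠ ⊤ := by
    refine ENNReal.mul_ne_top (ENNReal.rpow_ne_top_of_nonneg (by linarith) ?_) ENNReal.ofReal_ne_top
    exact ENNReal.mul_ne_top (by simp) ENNReal.ofReal_ne_top
  let C : ℝ≥0∞ := C₁ * A ^ (q : ℝ) * (C₂ * ((C₃ : ℝ≥0∞) ^ ((q : ℝ) / 2) * C₄))
  have hC : C ≠ ⊤ := by
    refine ENNReal.mul_ne_top (ENNReal.mul_ne_top ENNReal.coe_ne_top ?_)
      (ENNReal.mul_ne_top ENNReal.coe_ne_top (ENNReal.mul_ne_top ?_ hC₄))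
    · exact ENNReal.rpow_ne_top_of_nonneg hq0 ENNReal.coe_ne_top
    · exact ENNReal.rpow_ne_top_of_nonneg hq2 ENNReal.coe_ne_top
  refine ⟨C.toNNReal, fun δ hδ hδ1 m hm hms ι _ ξ hξ hsep f s => ?_⟩
  rw [ENNReal.coe_toNNReal hC]
  set φ : ℝ → ℂ := fun t => χ (t / δ) with hφ
  have hφsm : ContDiff ℝ (⊤ : ℕ∞) φ := hχsm.comp (by fun_prop)
  have hφ0 : ∀ t, 1 < |t| → φ t = 0 := fun t ht => by
    refine hχ0 _ ?_
    rw [abs_div, abs_of_pos hδ, le_div_iff₀ hδ]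
    nlinarith
  have hmφ : ∀ t, m t * φ t = m t := fun t => by
    by_cases ht : |t| ≤ c * δ
    · have : φ t = 1 := by
        refine hχ1 _ ?_
        rwa [abs_div, abs_of_pos hδ, div_le_iff₀ hδ]
      rw [this, mul_one]
    · rw [hms t (not_le.1 ht), zero_mul]
  have hφint : Integrable φ := hφsm.continuous.integrable_of_hasCompactSupport
    (hasCompactSupport_of_forall_lt_abs hφ0)
  -- the randomized coefficients
  let a : (ι → ℤˣ) → ℤ → ℂ := fun ε k => ∑ j, ((ε j : ℤ) : ℂ) * (f k * (𝐞 (-(ξ j * k)) : ℂ))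
  have hswap : ∀ (ε : ι → ℤˣ) (w : ℤ → ℂ), ∑ k ∈ s, a ε k * w k
      = ∑ j, ((ε j : ℤ) : ℂ) * ∑ k ∈ s, f k * (𝐞 (-(ξ j * k)) : ℂ) * w k := by
    intro ε w
    simp_rw [a, Finset.sum_mul, Finset.mul_sum]
    rw [Finset.sum_comm]
    simp_rw [mul_assoc]
  set N : ℝ≥0∞ := (Fintype.card (ι → ℤˣ) : ℝ≥0∞) with hN
  have hN0 : N ≠ 0 := by
    rw [hN]; exact_mod_cast Fintype.card_pos.ne'
  have hNtop : N ≠ ⊤ := ENNReal.natCast_ne_top _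
  have hmeas : ∀ ε : ι → ℤˣ, Measurable fun x : ℝ => ‖∑ k ∈ s, a ε k * 𝓕⁻ φ (x - k)‖ₑ ^ (q : ℝ) := by
    intro ε
    have := continuous_fourierInv hφint
    have : Continuous fun x : ℝ => ∑ k ∈ s, a ε k * 𝓕⁻ φ (x - k) := by fun_prop
    exact this.measurable.enorm.pow_const _
  rw [← ENNReal.mul_le_mul_iff_right hN0 hNtop]
  calc N * ∑' n : ℤ, (∑ j, ‖∑ k ∈ s, f k * (𝐞 (-(ξ j * k)) : ℂ) * kernel m (n - k)‖ₑ ^ 2)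
            ^ ((q : ℝ) / 2)
      ≤ ∑' n : ℤ, ∑ ε : ι → ℤˣ, ‖∑ k ∈ s, a ε k * kernel m (n - k)‖ₑ ^ (q : ℝ) := by
        rw [← ENNReal.tsum_mul_left]
        refine ENNReal.tsum_le_tsum fun n => ?_
        simp_rw [hswap]
        exact khintchine_lower_enorm hqR _
    _ = ∑ ε : ι → ℤˣ, ∑' n : ℤ, ‖∑ k ∈ s, a ε k * kernel m (n - k)‖ₑ ^ (q : ℝ) :=
        Summable.tsum_finsetSum fun _ _ => ENNReal.summable
    _ ≤ ∑ ε : ι → ℤˣ, C₁ * A ^ (q : ℝ) * ∫⁻ x, ‖∑ k ∈ s, a ε k * 𝓕⁻ φ (x - k)‖ₑ ^ (q : ℝ) :=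
        Finset.sum_le_sum fun ε _ => hC₁ A m φ hm hφsm hφ0 hmφ (a ε) s
    _ = C₁ * A ^ (q : ℝ) * ∫⁻ x, ∑ ε : ι → ℤˣ, ‖∑ k ∈ s, a ε k * 𝓕⁻ φ (x - k)‖ₑ ^ (q : ℝ) := by
        rw [← Finset.mul_sum, lintegral_finsetSum _ fun ε _ => hmeas ε]
    _ ≤ C₁ * A ^ (q : ℝ) * ∫⁻ x, C₂ * N * ((C₃ : ℝ≥0∞) ^ ((q : ℝ) / 2) *
          (∑ n ∈ s, cauchyKernel δ x n * ‖f n‖ₑ ^ 2) ^ ((q : ℝ) / 2)) := by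
        gcongr with x
        simp_rw [hswap]
        refine (hC₂ ι _).trans ?_
        rw [← ENNReal.mul_rpow_of_nonneg _ _ hq2]
        gcongr
        exact hC₃ δ hδ hδ1 ι ξ hξ hsep f s x
    _ = C₁ * A ^ (q : ℝ) * (C₂ * N * ((C₃ : ℝ≥0∞) ^ ((q : ℝ) / 2) *
          ∫⁻ x, (∑ n ∈ s, cauchyKernel δ x n * ‖f n‖ₑ ^ 2) ^ ((q : ℝ) / 2))) := by
        rw [lintegral_const_mul' _ _ (ENNReal.mul_ne_top ENNReal.coe_ne_top hNtop),
          lintegral_const_mul' _ _ (ENNReal.rpow_ne_top_of_nonneg hq2 ENNReal.coe_ne_top)]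
    _ ≤ C₁ * A ^ (q : ℝ) * (C₂ * N * ((C₃ : ℝ≥0∞) ^ ((q : ℝ) / 2) *
          (C₄ * ∑ n ∈ s, (‖f n‖ₑ ^ 2) ^ ((q : ℝ) / 2)))) := by
        gcongr
        exact lintegral_sum_cauchyKernel_rpow_le hq21 hδ hδ1 _ s
    _ = N * (C * ∑ k ∈ s, ‖f k‖ₑ ^ (q : ℝ)) := by
        have : ∀ n, (‖f n‖ₑ ^ 2) ^ ((q : ℝ) / 2) = ‖f n‖ₑ ^ (q : ℝ) := fun n => by
          rw [← ENNReal.rpow_two, ← ENNReal.rpow_mul, mul_div_cancel₀ _ two_ne_zero]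
        simp_rw [this, C]
        ring

/-! ### Separated sets, and passage to general sequences -/

lemma IsDeltaSeparated.le_abs_sub {δ : ℝ} {S : Set ℝ} (hS : IsDeltaSeparated δ S) {x y : ℝ}
    (hx : x ∈ S) (hy : y ∈ S) (hxy : x ≠ y) : δ ≤ |x - y| := by
  by_contra! h
  rw [abs_lt] at h
  -- both points lie in the interval of length `δ` centred at their midpoint
  refine hxy (hS ((x + y) / 2 - δ / 2) ⟨hx, ?_, ?_⟩ ⟨hy, ?_, ?_⟩) <;> linarith

lemma IsDeltaSeparated.finite {δ : ℝ} (hδ : 0 < δ) {S : Set ℝ} (hS : IsDeltaSeparated δ S)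
    {a b : ℝ} (hab : S ⊆ Set.Icc a b) : S.Finite := by
  refine Set.Finite.of_injOn (f := fun x => ⌊x / δ⌋) (t := Set.Icc ⌊a / δ⌋ ⌊b / δ⌋) ?_ ?_
    (Set.finite_Icc _ _)
  · intro x hx
    have := hab hx
    exact ⟨Int.floor_mono (div_le_div_of_nonneg_right this.1 hδ.le),
      Int.floor_mono (div_le_div_of_nonneg_right this.2 hδ.le)⟩
  · intro x hx y hy hxy
    by_contra hne
    have h1 := hS.le_abs_sub hx hy hne
    have h2 := Int.abs_sub_lt_one_of_floor_eq_floor hxy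
    rw [← sub_div, abs_div, abs_of_pos hδ, div_lt_one hδ] at h2
    linarith

lemma kernel_shift (m : ℝ → ℂ) (η x : ℝ) : kernel (shift m η) x = 𝐞 (η * x) * kernel m x :=
  fourierInv_comp_sub m η x

lemma norm_kernel_shift (m : ℝ → ℂ) (η x : ℝ) : ‖kernel (shift m η) x‖ = ‖kernel m x‖ := by
  rw [kernel_shift, norm_mul, norm_char, one_mul]

/-- Up to the unimodular factor `𝐞 (η n)`, the operator with shifted multiplier acts on `f` as the
unshifted one acts on a modulation of `f`. -/
lemma mul_kernel_shift (m : ℝ → ℂ) (η : ℝ) (f : ℤ → ℂ) (n k : ℤ) :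
    f k * kernel (shift m η) ((n - k : ℤ) : ℝ)
      = 𝐞 (η * n) * (f k * (𝐞 (-(η * k)) : ℂ) * kernel m (n - k)) := by
  have : (𝐞 (η * ((n - k : ℤ) : ℝ)) : ℂ) = 𝐞 (η * n) * 𝐞 (-(η * k)) := by
    rw [← Circle.coe_mul, ← AddChar.map_add_eq_mul]
    congr 2
    push_cast
    ring
  rw [kernel_shift, this]
  push_cast
  ring

/-- An `ℓ^p` bound for convolution of finitely supported sequences with `K` forces absolute
convergence of the convolution on all of `ℓ^p`: test it on `f` multiplied by phases that remove
all cancellation. -/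
lemma summable_norm_mul_of_forall_finset {q : ℝ≥0} (hq : q ≠ 0) {C : ℝ≥0} {K : ℤ → ℂ}
    (hK : ∀ (g : ℤ → ℂ) (s : Finset ℤ),
      ∑' n : ℤ, ‖∑ k ∈ s, g k * K (n - k)‖ₑ ^ (q : ℝ) ≤ C * ∑ k ∈ s, ‖g k‖ₑ ^ (q : ℝ))
    {f : ℤ → ℂ} (hf : ∑' k, ‖f k‖ₑ ^ (q : ℝ) ≠ ⊤) (n : ℤ) :
    Summable fun k => ‖f k * K (n - k)‖ := by
  have hq0 : (0 : ℝ) < q := by positivity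
  set M : ℝ≥0∞ := (C * ∑' k, ‖f k‖ₑ ^ (q : ℝ)) ^ (1 / (q : ℝ)) with hM
  have hMtop : M ≠ ⊤ :=
    ENNReal.rpow_ne_top_of_nonneg (by positivity) (ENNReal.mul_ne_top ENNReal.coe_ne_top hf)
  refine summable_of_sum_le (c := M.toReal) (fun k => norm_nonneg _) fun s => ?_
  -- for `z = 0` the phase `star z / ‖z‖` is `0`, which does no harm
  let g : ℤ → ℂ := fun k => f k * (star (f k * K (n - k)) / (‖f k * K (n - k)‖ : ℂ))
  have hg : ∀ k, ‖g k‖ₑ ≤ ‖f k‖ₑ := by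
    intro k
    rw [enorm_le_iff_norm_le, norm_mul]
    refine mul_le_of_le_one_right (norm_nonneg _) ?_
    rw [norm_div, norm_star, Complex.norm_real, norm_norm]
    exact div_self_le_one _
  have hgK : ∀ k, g k * K (n - k) = (‖f k * K (n - k)‖ : ℂ) := by
    intro k
    set z := f k * K (n - k) with hz
    have e : g k * K (n - k) = (star z * z) / (‖z‖ : ℂ) := by
      simp only [g, ← hz]
      rw [hz]
      ring
    rw [e, show star z * z = (‖z‖ : ℂ) ^ 2 from Complex.conj_mul' z, sq, mul_self_div_self]
  have h1 : (ENNReal.ofReal (∑ k ∈ s, ‖f k * K (n - k)‖)) ^ (q : ℝ)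
      ≤ C * ∑' k, ‖f k‖ₑ ^ (q : ℝ) := by
    have e : ENNReal.ofReal (∑ k ∈ s, ‖f k * K (n - k)‖) = ‖∑ k ∈ s, g k * K (n - k)‖ₑ := by
      simp_rw [hgK]
      rw [← Complex.ofReal_sum, ← ofReal_norm, Complex.norm_real, Real.norm_of_nonneg]
      exact Finset.sum_nonneg fun k _ => norm_nonneg _
    rw [e]
    calc ‖∑ k ∈ s, g k * K (n - k)‖ₑ ^ (q : ℝ)
        ≤ ∑' n : ℤ, ‖∑ k ∈ s, g k * K (n - k)‖ₑ ^ (q : ℝ) := ENNReal.le_tsum n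
      _ ≤ C * ∑ k ∈ s, ‖g k‖ₑ ^ (q : ℝ) := hK g s
      _ ≤ C * ∑ k ∈ s, ‖f k‖ₑ ^ (q : ℝ) := by
        gcongr with k
        exact hg k
      _ ≤ _ := by
        gcongr
        exact ENNReal.sum_le_tsum s
  have h2 : ENNReal.ofReal (∑ k ∈ s, ‖f k * K (n - k)‖) ≤ M := by
    rw [hM, one_div]
    exact (ENNReal.le_rpow_inv_iff hq0).2 h1
  exact (ENNReal.ofReal_le_iff_le_toReal hMtop).1 h2

lemma enorm_squareFunction_rpow {m : ℝ → ℂ} {S : Set ℝ} [Fintype S] (f : ℤ → ℂ) (n : ℤ) {p : ℝ}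
    (hp : 0 ≤ p) :
    ‖squareFunction m S f n‖ₑ ^ p
      = (∑ η : S, ‖discreteOp (shift m η) f n‖ₑ ^ 2) ^ (p / 2) := by
  have h0 : 0 ≤ ∑ η : S, ‖discreteOp (shift m η) f n‖ ^ 2 := by positivity
  rw [sum_enorm_sq_rpow_eq_ofReal hp, squareFunction, tsum_fintype, ← ofReal_norm,
    Real.norm_of_nonneg (Real.sqrt_nonneg _), Real.sqrt_eq_rpow,
    ENNReal.ofReal_rpow_of_nonneg (by positivity) hp, ← Real.rpow_mul h0]
  congr 2
  ring

/-- Fatou's lemma for sums over `ℤ` of limits of square functions along finite truncations. -/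
lemma tsum_sum_enorm_sq_rpow_le_of_hasSum {ι : Type*} [Fintype ι] {r : ℝ}
    {b : ι → ℤ → ℤ → ℂ} {T : ι → ℤ → ℂ} (hT : ∀ j n, HasSum (b j n) (T j n)) {B : ℝ≥0∞}
    (hB : ∀ s : Finset ℤ, ∑' n : ℤ, (∑ j, ‖∑ k ∈ s, b j n k‖ₑ ^ 2) ^ r ≤ B) :
    ∑' n : ℤ, (∑ j, ‖T j n‖ₑ ^ 2) ^ r ≤ B := by
  rw [ENNReal.tsum_eq_iSup_sum]
  refine iSup_le fun N => ?_
  have hlim : Filter.Tendsto (fun s : Finset ℤ => ∑ n ∈ N, (∑ j, ‖∑ k ∈ s, b j n k‖ₑ ^ 2) ^ r)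
      Filter.atTop (nhds (∑ n ∈ N, (∑ j, ‖T j n‖ₑ ^ 2) ^ r)) := by
    refine tendsto_finsetSum _ fun n _ => ?_
    refine (ENNReal.continuous_rpow_const.tendsto _).comp ?_
    refine tendsto_finsetSum _ fun j _ => ?_
    exact ((ENNReal.continuous_pow 2).tendsto _).comp ((hT j n).enorm)
  exact le_of_tendsto' hlim fun s => (ENNReal.sum_le_tsum N).trans (hB s)

end DiscreteMultiplier

theorem mainTheorem6 (p : ℝ≥0∞) (hp : 2 ≤ p) (hp' : p < ∞) (c₀ : ℝ) (hc₀ : c₀ < 1 / 2)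
    (A : ℝ≥0) :
    ∃ C : ℝ≥0, ∀ δ : ℝ, 0 < δ → δ < 1 →
      ∀ m : ℝ → ℂ, DiscreteMultiplier.IsLpMultiplier p A m →
        (∀ ξ : ℝ, c₀ * δ < |ξ| → m ξ = 0) →
        ∀ S : Set ℝ, S ⊆ Set.Ioc (-(1 / 2) : ℝ) (1 / 2) →
          DiscreteMultiplier.IsDeltaSeparated δ S →
          ∀ f : ℤ → ℂ, MemLp f p Measure.count →
            (∀ η ∈ S, ∀ n : ℤ, Summable fun k : ℤ =>
              f (n - k) * DiscreteMultiplier.kernel (DiscreteMultiplier.shift m η) (k : ℝ)) ∧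
            eLpNorm (DiscreteMultiplier.squareFunction m S f) p Measure.count
              ≤ C * eLpNorm f p Measure.count := by
  open DiscreteMultiplier in
  lift p to ℝ≥0 using hp'.ne
  have hq : 2 ≤ p := by exact_mod_cast hp
  have hp0 : p ≠ 0 := by rintro rfl; simp at hq
  have hpR : (0 : ℝ) < p := by positivity
  -- the support condition only gets weaker when `c₀` is enlarged to a positive number
  obtain ⟨C, hC⟩ := exists_squareFunction_bound_of_finite hq (c := max c₀ (1 / 4)) (by positivity)
    (max_lt hc₀ (by norm_num)) A
  refine ⟨C ^ (1 / (p : ℝ)), fun δ hδ hδ1 m hm hms S hSI hS f hf => ?_⟩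
  have hms' : ∀ ξ, max c₀ (1 / 4) * δ < |ξ| → m ξ = 0 := fun ξ hξ =>
    hms ξ (lt_of_le_of_lt (mul_le_mul_of_nonneg_right (le_max_left _ _) hδ.le) hξ)
  have hbound := hC δ hδ hδ1.le m hm hms'
  have hSabs : ∀ η ∈ S, |η| ≤ 1 / 2 := fun η hη =>
    abs_le.2 ⟨(hSI hη).1.le, (hSI hη).2⟩
  have : Fintype S := (hS.finite hδ (hSI.trans Set.Ioc_subset_Icc_self)).fintype
  have hfe : eLpNorm f p Measure.count ^ (p : ℝ) = ∑' k, ‖f k‖ₑ ^ (p : ℝ) := by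
    rw [eLpNorm_nnreal_pow_eq_lintegral hp0, lintegral_count]
  have hftop : ∑' k, ‖f k‖ₑ ^ (p : ℝ) ≠ ⊤ := by
    rw [← hfe]
    exact ENNReal.rpow_ne_top_of_nonneg hpR.le hf.2.ne
  -- absolute convergence, from the bound for the single frequency `0`
  have hsum0 : ∀ n : ℤ, Summable fun k : ℤ => ‖f k * kernel m ((n - k : ℤ) : ℝ)‖ := by
    refine summable_norm_mul_of_forall_finset (K := fun k : ℤ => kernel m k) hp0 (C := C)
      (fun g s => ?_) hftop
    have := hbound Unit (fun _ => 0) (by simp) (fun i j hij => absurd rfl hij) g s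
    have e : ∀ x : ℝ≥0∞, (x ^ 2) ^ ((p : ℝ) / 2) = x ^ (p : ℝ) := fun x => by
      rw [← ENNReal.rpow_two, ← ENNReal.rpow_mul, mul_div_cancel₀ _ two_ne_zero]
    simpa [e] using this
  have hsum : ∀ η (n : ℤ), Summable fun k : ℤ => f k * kernel (shift m η) ((n - k : ℤ) : ℝ) := by
    intro η n
    refine Summable.of_norm ((hsum0 n).congr fun k => ?_)
    rw [norm_mul, norm_mul, norm_kernel_shift]
  have hHas : ∀ η (n : ℤ), HasSum (fun k : ℤ => f k * kernel (shift m η) ((n - k : ℤ) : ℝ))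
      (discreteOp (shift m η) f n) := by
    intro η n
    have e : discreteOp (shift m η) f n = ∑' k : ℤ, f k * kernel (shift m η) ((n - k : ℤ) : ℝ) := by
      rw [discreteOp, ← (Equiv.subLeft n).tsum_eq]
      simp
    rw [e]
    exact (hsum η n).hasSum
  refine ⟨fun η _ n => ?_, ?_⟩
  · have := (Equiv.subLeft n).summable_iff.2 (hsum η n)
    simpa [Function.comp_def] using this
  · have key : ∑' n : ℤ, (∑ η : S, ‖discreteOp (shift m η) f n‖ₑ ^ 2) ^ ((p : ℝ) / 2)
        ≤ C * ∑' k, ‖f k‖ₑ ^ (p : ℝ) := by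
      refine tsum_sum_enorm_sq_rpow_le_of_hasSum
        (fun (η : S) n => hHas η n) fun s => ?_
      have h1 := hbound S (fun η => (η : ℝ)) (fun η => hSabs η η.2)
        (fun i j hij => hS.le_abs_sub i.2 j.2 (Subtype.coe_injective.ne hij)) f s
      have e : ∀ z w : ℂ, ‖z‖ = 1 → ‖z * w‖ₑ = ‖w‖ₑ := fun z w hz => by
        rw [← ofReal_norm, norm_mul, hz, one_mul, ofReal_norm]
      simp_rw [mul_kernel_shift, ← Finset.mul_sum, e _ _ (norm_char _)]
      refine h1.trans ?_
      gcongr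
      exact ENNReal.sum_le_tsum s
    have hpow : eLpNorm (squareFunction m S f) p Measure.count ^ (p : ℝ)
        ≤ C * eLpNorm f p Measure.count ^ (p : ℝ) := by
      rw [eLpNorm_nnreal_pow_eq_lintegral hp0, lintegral_count, hfe]
      simp_rw [enorm_squareFunction_rpow f _ hpR.le]
      exact key
    refine (ENNReal.rpow_le_rpow_iff hpR).1 ?_
    rw [ENNReal.mul_rpow_of_nonneg _ _ hpR.le, ← ENNReal.coe_rpow_of_nonneg _ (by positivity),
      ← NNReal.rpow_mul, one_div_mul_cancel hpR.ne', NNReal.rpow_one]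
    exact hpow
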